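/- Let $d\ge 1$. A \emph{$d$-polytope} is the convex hull $P\subset\mathbb{R}^d$ of finitely many points whose affine span is $\mathbb{R}^d$. Two polytopes are combinatorially equivalent if their face lattices are isomorphic. A $d$-polytope $P$ is \emph{inscribable} if some $d$-polytope combinatorially equivalent to $P$ has all its vertices on a sphere. If $v_1,\dots,v_n$ are the (distinct) vertices of $P$ and $P=\{x\in\mathbb{R}^d : h_j^\top x\le c_j,\ j=1,\dots,m\}$ with exactly one inequality for each facet of $P$, then the matrix $S^0\in\mathbb{R}^{n\times m}$ with $S^0_{ij}=c_j-h_j^\top v_i$ is called a \emph{slack matrix} of $P$. The support of a matrix is the set of positions of its nonzero entries. For matrices $A\in\mathbb{R}^{n\times n}$, $S\in\mathbb{R}^{n\times m}$, $B\in\mathbb{R}^{m\times m}$ put $$X(A,S,B)=\begin{bmatrix}1&\mathbf 1_n^\top&\mathbf 1_m^\top\\ \mathbf 1_n&A&S\\ \mathbf 1_m&S^\top&B\end{bmatrix},$$ where $\mathbf 1_k\in\mathbb{R}^k$ is the all-ones vector. **Theorem.** Let $P$ be a $d$-polytope, $d\ge 1$. 1. $P$ is inscribable if and only if there are a slack matrix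 $S^0$ of $P$ and matrices $A,S,B$ such that $X(A,S,B)$ is symmetric positive semidefinite of rank $d+1$, all diagonal entries of $A$ are equal, all entries of $S$ are nonnegative, and $S$ has the same support as $S^0$. Moreover, for every fixed slack matrix $S^0$ of $P$, $P$ is inscribable if and only if such $A,S,B$ exist for this $S^0$. 2. For every slack matrix $S^0$ of $P$, $P$ is inscribable if and only if the minimum rank problem $$\min_{A,S,B}\ \operatorname{rank}X(A,S,B)\quad\text{s.t.}\quad X(A,S,B)\succeq 0,\quad S_{ij}=0\ \text{if } S^0_{ij}=0,\quad S_{ij}>0\ \text{if } S^0_{ij}\ne 0,\quad A_{ii}=2\ (i=1,\dots,n)$$ attains its minimum and the minimum is $d+1$. -/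

import Mathlib

namespace Inscribability

/-- A `d`-polytope in `ℝ^d`: the convex hull of finitely many points that affinely spans `ℝ^d`. -/
def IsDPolytope {d : ℕ} (P : Set (EuclideanSpace ℝ (Fin d))) : Prop :=
  (∃ T : Finset (EuclideanSpace ℝ (Fin d)), P = convexHull ℝ (T : Set (EuclideanSpace ℝ (Fin d)))) ∧
    affineSpan ℝ P = ⊤

/-- The faces of `P` (including `∅` and `P` itself), ordered by inclusion. Mathlib's exposed
subsets are `∅` and the sets of maximizers over `P` of a continuous linear functional. -/
abbrev FaceLattice {d : ℕ} (P : Set (EuclideanSpace ℝ (Fin d))) : Type :=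
  {F : Set (EuclideanSpace ℝ (Fin d)) // IsExposed ℝ P F}

/-- Two polytopes are combinatorially equivalent if their face lattices are isomorphic. -/
def CombEquiv {d : ℕ} (P Q : Set (EuclideanSpace ℝ (Fin d))) : Prop :=
  Nonempty (FaceLattice P ≃o FaceLattice Q)

/-- `P` is inscribable: some `d`-polytope combinatorially equivalent to `P` has all its vertices
on a sphere. -/
def IsInscribable {d : ℕ} (P : Set (EuclideanSpace ℝ (Fin d))) : Prop :=
  ∃ Q : Set (EuclideanSpace ℝ (Fin d)), IsDPolytope Q ∧ CombEquiv P Q ∧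
    ∃ (o : EuclideanSpace ℝ (Fin d)) (r : ℝ), 0 < r ∧ Q.extremePoints ℝ ⊆ Metric.sphere o r

/-- `F` is a facet of the `d`-polytope `P`: a nonempty face of dimension `d - 1`. -/
def IsFacet {d : ℕ} (P F : Set (EuclideanSpace ℝ (Fin d))) : Prop :=
  IsExposed ℝ P F ∧ F.Nonempty ∧ Module.finrank ℝ (vectorSpan ℝ F) + 1 = d

/-- `S` is a slack matrix of `P`: the rows are indexed by an enumeration `v` of the vertices of `P`,
the columns by inequalities `⟪h j, x⟫ ≤ c j` describing `P`, one for each facet, and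
`S i j = c j - ⟪h j, v i⟫`. -/
def IsSlackMatrix {d n m : ℕ} (P : Set (EuclideanSpace ℝ (Fin d)))
    (S : Matrix (Fin n) (Fin m) ℝ) : Prop :=
  ∃ (v : Fin n → EuclideanSpace ℝ (Fin d)) (h : Fin m → EuclideanSpace ℝ (Fin d)) (c : Fin m → ℝ),
    Function.Injective v ∧ Set.range v = P.extremePoints ℝ ∧
    P = {x | ∀ j, inner ℝ (h j) x ≤ c j} ∧
    (∀ j, IsFacet P {x ∈ P | inner ℝ (h j) x = c j}) ∧
    Function.Injective (fun j => {x ∈ P | inner ℝ (h j) x = c j}) ∧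
    ∀ i j, S i j = c j - inner ℝ (h j) (v i)

/-- The matrix `[[1, 1ᵀ, 1ᵀ], [1, A, S], [1, Sᵀ, B]]`. -/
def bordered {n m : ℕ} (A : Matrix (Fin n) (Fin n) ℝ) (S : Matrix (Fin n) (Fin m) ℝ)
    (B : Matrix (Fin m) (Fin m) ℝ) : Matrix (Unit ⊕ (Fin n ⊕ Fin m)) (Unit ⊕ (Fin n ⊕ Fin m)) ℝ :=
  Matrix.fromBlocks (Matrix.of fun _ _ => 1) (Matrix.of fun _ _ => 1) (Matrix.of fun _ _ => 1)
    (Matrix.fromBlocks A S S.transpose B)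

/-- `S` has the same support (set of nonzero positions) as `S₀`. -/
def SameSupport {n m : ℕ} (S S₀ : Matrix (Fin n) (Fin m) ℝ) : Prop :=
  ∀ i j, S i j ≠ 0 ↔ S₀ i j ≠ 0

/-- The blocks `A, S, B` give a positive semidefinite bordered matrix of rank `d + 1` with constant
diagonal in the block `A` and `S` entrywise nonnegative with the support of `S₀`. -/
def IsCertificate {n m : ℕ} (d : ℕ) (S₀ : Matrix (Fin n) (Fin m) ℝ)
    (A : Matrix (Fin n) (Fin n) ℝ) (S : Matrix (Fin n) (Fin m) ℝ)
    (B : Matrix (Fin m) (Fin m) ℝ) : Prop :=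
  (bordered A S B).PosSemidef ∧ (bordered A S B).rank = d + 1 ∧
    (∃ a : ℝ, ∀ i, A i i = a) ∧ (∀ i j, 0 ≤ S i j) ∧ SameSupport S S₀

/-- Feasibility for the minimum rank problem attached to the zero pattern of the slack
matrix `S₀`. -/
def IsFeasible {n m : ℕ} (S₀ : Matrix (Fin n) (Fin m) ℝ)
    (A : Matrix (Fin n) (Fin n) ℝ) (S : Matrix (Fin n) (Fin m) ℝ)
    (B : Matrix (Fin m) (Fin m) ℝ) : Prop :=
  (bordered A S B).PosSemidef ∧ (∀ i j, S₀ i j = 0 → S i j = 0) ∧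
    (∀ i j, S₀ i j ≠ 0 → 0 < S i j) ∧ ∀ i, A i i = 2

/-- The ranks attained by feasible points of the minimum rank problem. -/
def feasibleRanks {n m : ℕ} (S₀ : Matrix (Fin n) (Fin m) ℝ) : Set ℕ :=
  {r | ∃ A S B, IsFeasible S₀ A S B ∧ (bordered A S B).rank = r}

end Inscribability

/-!
A polytope in `ℝ^d` is homogenized to a cone in `ℝ × ℝ^d`: a vertex `v` becomes the generator
`(1, v)` and a facet inequality `⟪g, x⟫ ≤ c` the functional `(t, x) ↦ c t - ⟪g, x⟫`. The slack matrix
is then the matrix of values of the functionals on the generators, and its zero pattern is the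
vertex-facet incidence relation.

From an inscribed polytope to a certificate. Let `Q` have its vertices on the unit sphere and be
combinatorially equivalent to `P`. Vertices of `P` correspond to vertices of `Q`, since these are the
atoms of the face lattices, and facets of `P` to proper faces of `Q`. A projective transformation
preserving the sphere (`exists_recentering`) moves an interior point of `Q` to the origin, so that
the inequalities supporting these faces become `0 ≤ 1 + ⟪q j, x⟫`, while the vertices become unit
vectors `p i`. The Gram matrix of `(1, 0)`, `(1, p i)`, `(1, q j)` is the bordered matrix sought, with
`A i i = 1 + ‖p i‖ ^ 2 = 2`.

Lower bound for the rank. Going down from one face of `P` to a facet of it that contains a prescribed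
smaller face (`Realizes.exists_facetsOf`) produces chains of faces along which the dimension drops by
one at each step. In any matrix with the zero pattern of the slack matrix, the span of the rows
belonging to a face strictly decreases along such a chain, so the rank is at least `d + 1`
(`Realizes.finrank_le_finrank`).

From a certificate to an inscribed polytope. A positive semidefinite bordered matrix of rank `d + 1`
is a Gram matrix, and splitting off the unit vector of the first row gives `p i`, `q j` in `ℝ^d` with
`S i j = 1 + ⟪p i, q j⟫` and all `p i` of the same norm. It remains to see that the convex hull of the
`p i` is combinatorially equivalent to `P`. The face lattice of a polytope given by points and
inequalities is the concept lattice of the incidence relation between them, so it is enough that this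
convex hull is the solution set of the inequalities `0 ≤ 1 + ⟪q j, x⟫`. This is
`Realizes.mem_coneOn_of_realizes`: a realization of the pattern in the minimal dimension is a cone
together with its defining inequalities. By the rank bound, applied above and below each face, every
face has the same dimension as in `P`. By induction on this dimension, a point of the span of a face
that satisfies the inequalities of the facets of the face lies in the cone over the face: subtracting
a multiple of a generator moves it into the span of a facet, and the inequalities needed there are
positive multiples of inequalities of the original face, because each ridge of the face lies in a
second facet.
-/

/-! ### Cones with a prescribed vertex-facet incidence pattern -/

namespace Inscribability

section Pattern

variable {I J V W : Type*} [AddCommGroup V] [Module ℝ V]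
  [AddCommGroup W] [Module ℝ W]

/-- The generators `a` and the functionals `h` are nonnegative on each other and realize the
incidence relation `R`: the functional `h j` vanishes at `a i` exactly when `R i j`. -/
structure Realizes (R : I → J → Prop) (a : I → V) (h : J → Module.Dual ℝ V) : Prop where
  nonneg : ∀ i j, 0 ≤ h j (a i)
  zero_iff : ∀ i j, h j (a i) = 0 ↔ R i j

/-- The convex cone generated by the `a i` with `i ∈ F`. -/
def coneOn (a : I → V) (F : Set I) : PointedCone ℝ V := PointedCone.hull ℝ (a '' F)

/-- The functionals `h j`, `j ∈ K`, cut out the cone over `F` inside its linear span. -/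
def CutsOut (a : I → V) (h : J → Module.Dual ℝ V) (F : Set I) (K : Set J) : Prop :=
  ∀ x ∈ Submodule.span ℝ (a '' F), (∀ j ∈ K, 0 ≤ h j x) → x ∈ coneOn a F

/-- The indices `j` for which `F ∩ {i | R i j}` is a facet of the face `F`. The dimension of a face
is measured by the span of the generators it contains. -/
def facetsOf (R : I → J → Prop) (a : I → V) (F : Set I) : Set J :=
  {j | (∃ i ∈ F, ¬ R i j) ∧
    Module.finrank ℝ (Submodule.span ℝ (a '' (F ∩ {i | R i j}))) + 1 =
      Module.finrank ℝ (Submodule.span ℝ (a '' F))}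

theorem exists_pos_forall_add_mul_nonneg [Finite J] (α β : J → ℝ) (K : Set J) (hα : ∀ j ∈ K, 0 ≤ α j)
    (hβ : ∀ j ∈ K, α j = 0 → 0 ≤ β j) : ∃ ε > 0, ∀ j ∈ K, 0 ≤ α j + ε * β j := by
  have : ∀ᶠ ε in nhdsWithin (0 : ℝ) (Set.Ioi 0), ∀ j, j ∈ K → 0 ≤ α j + ε * β j := by
    rw [Filter.eventually_all]
    intro j
    by_cases hj : j ∈ K
    · rcases (hα j hj).eq_or_lt with h0 | hpos
      · filter_upwards [self_mem_nhdsWithin] with ε hε _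
        have := mul_nonneg (le_of_lt hε) (hβ j hj h0.symm)
        linarith
      · have hc : Filter.Tendsto (fun ε : ℝ => α j + ε * β j) (nhdsWithin 0 (Set.Ioi 0))
            (nhds (α j + 0 * β j)) :=
          ((continuous_const.add (continuous_id.mul continuous_const)).tendsto 0).mono_left
            nhdsWithin_le_nhds
        have := hc.eventually_const_lt (show (0 : ℝ) < α j + 0 * β j by simpa using hpos)
        filter_upwards [this] with ε hε _ using hε.le
    · exact Filter.Eventually.of_forall fun _ h => absurd h hj
  obtain ⟨ε, h1, h2⟩ := (this.and self_mem_nhdsWithin).exists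
  exact ⟨ε, h2, h1⟩

theorem mem_coneOn {a : I → V} {F : Set I} {i : I} (hi : i ∈ F) : a i ∈ coneOn a F :=
  Submodule.subset_span (Set.mem_image_of_mem a hi)

theorem coneOn_mono {a : I → V} {F G : Set I} (h : F ⊆ G) : coneOn a F ≤ coneOn a G :=
  Submodule.span_mono (Set.image_mono h)

theorem coneOn_le_span {a : I → V} {F : Set I} {x : V} (hx : x ∈ coneOn a F) :
    x ∈ Submodule.span ℝ (a '' F) := by
  have : coneOn a F ≤ (Submodule.span ℝ (a '' F)).restrictScalars _ :=
    Submodule.span_le.2 Submodule.subset_span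
  exact this hx

theorem smul_mem_coneOn {a : I → V} {F : Set I} {x : V} {t : ℝ} (ht : 0 ≤ t)
    (hx : x ∈ coneOn a F) : t • x ∈ coneOn a F :=
  (coneOn a F).smul_mem ht hx

theorem mem_span_image {a : I → V} {F : Set I} {i : I} (hi : i ∈ F) :
    a i ∈ Submodule.span ℝ (a '' F) :=
  Submodule.subset_span (Set.mem_image_of_mem a hi)

theorem span_image_mono {a : I → V} {F G : Set I} (h : F ⊆ G) :
    Submodule.span ℝ (a '' F) ≤ Submodule.span ℝ (a '' G) :=
  Submodule.span_mono (Set.image_mono h)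

theorem eq_zero_of_mem_span {a : I → V} {F : Set I} {f : Module.Dual ℝ V}
    (hf : ∀ i ∈ F, f (a i) = 0) {x : V} (hx : x ∈ Submodule.span ℝ (a '' F)) : f x = 0 := by
  have : Submodule.span ℝ (a '' F) ≤ LinearMap.ker f := by
    rw [Submodule.span_le]
    rintro _ ⟨i, hi, rfl⟩
    exact hf i hi
  exact this hx

theorem nonneg_of_mem_coneOn {a : I → V} {F : Set I} {f : Module.Dual ℝ V}
    (hf : ∀ i ∈ F, 0 ≤ f (a i)) {x : V} (hx : x ∈ coneOn a F) : 0 ≤ f x := by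
  induction hx using Submodule.span_induction with
  | mem x hx => obtain ⟨i, hi, rfl⟩ := hx; exact hf i hi
  | zero => simp
  | add x y _ _ hx hy => rw [map_add]; exact add_nonneg hx hy
  | smul c x _ hx =>
    have : c • x = (c : ℝ) • x := rfl
    rw [this, map_smul]
    exact mul_nonneg c.2 hx

/-- A functional that is nonnegative on the generators and vanishes at a point of the cone vanishes
at all generators used by that point. -/
theorem mem_coneOn_inter_of_eq_zero {a : I → V} {F : Set I} {f : Module.Dual ℝ V}
    (hf : ∀ i ∈ F, 0 ≤ f (a i)) {x : V} (hx : x ∈ coneOn a F) (h0 : f x = 0) :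
    x ∈ coneOn a (F ∩ {i | f (a i) = 0}) := by
  suffices h : 0 ≤ f x ∧ (f x = 0 → x ∈ coneOn a (F ∩ {i | f (a i) = 0})) from h.2 h0
  clear h0
  induction hx using Submodule.span_induction with
  | mem x hx =>
    obtain ⟨i, hi, rfl⟩ := hx
    exact ⟨hf i hi, fun h => mem_coneOn ⟨hi, h⟩⟩
  | zero => exact ⟨by simp, fun _ => zero_mem _⟩
  | add x y _ _ hx hy =>
    rw [map_add]
    refine ⟨add_nonneg hx.1 hy.1, fun h => ?_⟩
    exact add_mem (hx.2 (by linarith [hx.1, hy.1])) (hy.2 (by linarith [hx.1, hy.1]))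
  | smul c x _ hx =>
    have hc : c • x = (c : ℝ) • x := rfl
    rw [hc, map_smul, smul_eq_mul]
    refine ⟨mul_nonneg c.2 hx.1, fun h => ?_⟩
    rcases mul_eq_zero.1 h with h | h
    · rw [h, zero_smul]; exact zero_mem _
    · exact smul_mem_coneOn c.2 (hx.2 h)

variable {R : I → J → Prop} {a : I → V} {h : J → Module.Dual ℝ V}

/-- A point of the relative interior of the cone over `F`. -/
theorem Realizes.exists_interior_point [Finite I] (hr : Realizes R a h) (F : Set I) :
    ∃ x ∈ coneOn a F, ∀ j, 0 ≤ h j x ∧ (h j x = 0 ↔ ∀ i ∈ F, R i j) := by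
  classical
  have := Fintype.ofFinite I
  refine ⟨∑ i with i ∈ F, a i, Submodule.sum_mem _ fun i hi => mem_coneOn (by simpa using hi),
    fun j => ?_⟩
  rw [map_sum]
  refine ⟨Finset.sum_nonneg fun i _ => hr.nonneg i j, ?_⟩
  rw [Finset.sum_eq_zero_iff_of_nonneg fun i _ => hr.nonneg i j]
  simp [hr.zero_iff]

theorem isExtent_inter_column {F : Set I} (hF : Order.IsExtent R F) (j : J) :
    Order.IsExtent R (F ∩ {i | R i j}) := by
  refine hF.inter ⟨{j}, ?_⟩
  ext i; simp

theorem mem_of_isExtent {F : Set I} (hF : Order.IsExtent R F) {i : I}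
    (hi : ∀ j, (∀ i' ∈ F, R i' j) → R i j) : i ∈ F := by
  rw [Order.isExtent_iff] at hF
  rw [← hF]
  exact fun j hj => hi j fun i' hi' => hj hi'

/-- If the functionals cut out the whole cone, they cut out each of its faces. -/
theorem Realizes.mem_coneOn_of_nonneg [Finite J] (hr : Realizes R a h)
    (hc : ∀ x, (∀ j, 0 ≤ h j x) → x ∈ coneOn a Set.univ) {F : Set I} (hF : Order.IsExtent R F)
    {x : V} (hx : x ∈ Submodule.span ℝ (a '' F)) (hn : ∀ j, 0 ≤ h j x) : x ∈ coneOn a F := by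
  classical
  have := Fintype.ofFinite J
  -- the sum of all functionals vanishing on `F` exposes `F`
  have := mem_coneOn_inter_of_eq_zero (f := ∑ j with ∀ i ∈ F, R i j, h j) (F := Set.univ)
    (fun i _ => by
      rw [LinearMap.sum_apply]
      exact Finset.sum_nonneg fun j _ => hr.nonneg i j) (hc x hn) (by
      rw [LinearMap.sum_apply]
      refine Finset.sum_eq_zero fun j hj => ?_
      refine eq_zero_of_mem_span (fun i hi => (hr.zero_iff i j).2 ?_) hx
      exact (Finset.mem_filter.1 hj).2 i hi)
  refine coneOn_mono ?_ this
  rintro i ⟨-, hi⟩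
  refine mem_of_isExtent hF fun j hj => ?_
  rw [Set.mem_ofPred_eq, LinearMap.sum_apply,
    Finset.sum_eq_zero_iff_of_nonneg fun j _ => hr.nonneg i j] at hi
  exact (hr.zero_iff i j).1 (hi j (by simpa using hj))

variable [FiniteDimensional ℝ V]

/-- The facets of a face `F` cut out the cone over `F`: in an irredundant system of inequalities,
each inequality defines a facet. -/
theorem Realizes.cutsOut_facetsOf [Finite I] [Finite J] (hr : Realizes R a h)
    (hc : ∀ x, (∀ j, 0 ≤ h j x) → x ∈ coneOn a Set.univ) {F : Set I} (hF : Order.IsExtent R F) :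
    CutsOut a h F (facetsOf R a F) := by
  obtain ⟨K, hK, hmin⟩ := (Set.toFinite {K : Set J | CutsOut a h F K}).exists_minimal
    ⟨Set.univ, fun x hx hn => hr.mem_coneOn_of_nonneg hc hF hx fun j => hn j trivial⟩
  suffices hsub : K ⊆ facetsOf R a F from fun x hx hn => hK x hx fun j hj => hn j (hsub hj)
  intro j hj
  have hnot : ¬ CutsOut a h F (K \ {j}) := fun hcut => (hmin hcut Set.sdiff_subset hj).2 rfl
  simp only [CutsOut, not_forall] at hnot
  obtain ⟨y, hyF, hyK, hy⟩ := hnot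
  have hyj : h j y < 0 := by
    by_contra hcon
    refine hy (hK y hyF fun l hl => ?_)
    by_cases hlj : l = j
    · rw [hlj]; exact not_lt.1 hcon
    · exact hyK l ⟨hl, hlj⟩
  have hex : ∃ i ∈ F, ¬ R i j := by
    by_contra! hcon
    exact hyj.ne (eq_zero_of_mem_span (fun i hi => (hr.zero_iff i j).2 (hcon i hi)) hyF)
  obtain ⟨x, hxF, hx⟩ := hr.exists_interior_point F
  have hxj : 0 < h j x := by
    refine lt_of_le_of_ne (hx j).1 fun h0 => ?_
    obtain ⟨i, hi, hij⟩ := hex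
    exact hij ((hx j).2.1 h0.symm i hi)
  -- the segment from `y` to `x` meets the hyperplane of `h j` in a point `z` of the facet
  set z := h j x • y - h j y • x with hz
  have hzF : z ∈ Submodule.span ℝ (a '' F) :=
    sub_mem (Submodule.smul_mem _ _ hyF) (Submodule.smul_mem _ _ (coneOn_le_span hxF))
  have hzj : h j z = 0 := by simp [hz]; ring
  have key : ∀ w ∈ Submodule.span ℝ (a '' F), h j w = 0 →
      w ∈ Submodule.span ℝ (a '' (F ∩ {i | R i j})) := by
    have step : ∀ w ∈ Submodule.span ℝ (a '' F), h j w = 0 → ∃ ε > (0 : ℝ),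
        z + ε • w ∈ Submodule.span ℝ (a '' (F ∩ {i | R i j})) := by
      intro w hw hwj
      have hnn : ∀ l ∈ K, 0 ≤ h l z ∧ (h l z = 0 → 0 ≤ h l w) := by
        intro l hl
        by_cases hlj : l = j
        · subst hlj; simp [hzj, hwj]
        have h1 := hyK l ⟨hl, hlj⟩
        have h2 : h l z = h j x * h l y + (-h j y) * h l x := by simp [hz]; ring
        have h3 := mul_nonneg hxj.le h1
        have h4 := mul_nonneg (neg_pos.2 hyj).le (hx l).1
        refine ⟨by linarith, fun h0 => ?_⟩
        have h5 : h l x = 0 := by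
          rcases mul_eq_zero.1 (show (-h j y) * h l x = 0 by linarith) with h6 | h6
          · linarith
          · exact h6
        rw [eq_zero_of_mem_span (fun i hi => (hr.zero_iff i l).2 ((hx l).2.1 h5 i hi)) hw]
      obtain ⟨ε, hε, hεK⟩ := exists_pos_forall_add_mul_nonneg (fun l => h l z) (fun l => h l w) K
        (fun l hl => (hnn l hl).1) (fun l hl => (hnn l hl).2)
      refine ⟨ε, hε, ?_⟩
      have hmem : z + ε • w ∈ coneOn a F :=
        hK _ (add_mem hzF (Submodule.smul_mem _ _ hw)) fun l hl => by simpa using hεK l hl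
      have := mem_coneOn_inter_of_eq_zero (fun i _ => hr.nonneg i j) hmem (by simp [hzj, hwj])
      simp only [hr.zero_iff] at this
      exact coneOn_le_span this
    intro w hw hwj
    obtain ⟨ε, hε, h1⟩ := step w hw hwj
    obtain ⟨δ, hδ, h2⟩ := step 0 (zero_mem _) (map_zero _)
    have h3 := Submodule.smul_mem _ ε⁻¹ (sub_mem h1 h2)
    rwa [smul_zero, add_zero, add_sub_cancel_left, inv_smul_smul₀ hε.ne'] at h3
  refine ⟨hex, ?_⟩
  obtain ⟨i, hi, hij⟩ := hex
  have hij' : h j (a i) ≠ 0 := fun h0 => hij ((hr.zero_iff i j).1 h0)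
  have hsup : Submodule.span ℝ (a '' (F ∩ {i | R i j})) ⊔ Submodule.span ℝ {a i} =
      Submodule.span ℝ (a '' F) := by
    refine le_antisymm (sup_le (span_image_mono Set.inter_subset_left) ?_) fun w hw => ?_
    · rw [Submodule.span_singleton_le_iff_mem]; exact mem_span_image hi
    · have := key (w - (h j w / h j (a i)) • a i)
        (sub_mem hw (Submodule.smul_mem _ _ (mem_span_image hi))) (by simp [hij'])
      rw [← sub_add_cancel w ((h j w / h j (a i)) • a i)]
      exact Submodule.add_mem_sup this
        (Submodule.smul_mem _ _ (Submodule.mem_span_singleton_self _))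
  rw [← hsup, Submodule.finrank_sup_span_singleton
    fun hmem => hij' (eq_zero_of_mem_span (fun i' hi' => (hr.zero_iff i' j).2 hi'.2) hmem)]

/-- A proper face `G` of a face `F` is the intersection of the facets of `F` containing it. -/
theorem Realizes.exists_facetsOf [Finite I] [Finite J] (hr : Realizes R a h)
    (hc : ∀ x, (∀ j, 0 ≤ h j x) → x ∈ coneOn a Set.univ) {F G : Set I} (hF : Order.IsExtent R F)
    (hG : Order.IsExtent R G) (hGF : G ⊆ F) {i : I} (hi : i ∈ F) (hiG : i ∉ G) :
    ∃ j ∈ facetsOf R a F, (∀ i' ∈ G, R i' j) ∧ ¬ R i j := by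
  by_contra! hcon
  obtain ⟨x, hxG, hx⟩ := hr.exists_interior_point G
  obtain ⟨ε, hε, hεK⟩ := exists_pos_forall_add_mul_nonneg (fun l => h l x) (fun l => -h l (a i))
    (facetsOf R a F) (fun l _ => (hx l).1) fun l hl h0 => by
      rw [(hr.zero_iff i l).2 (hcon l hl ((hx l).2.1 h0)), neg_zero]
  have hmem : x - ε • a i ∈ coneOn a F := hr.cutsOut_facetsOf hc hF _
    (sub_mem (coneOn_le_span (coneOn_mono hGF hxG)) (Submodule.smul_mem _ _ (mem_span_image hi)))
    fun j hj => by simpa [sub_eq_add_neg] using hεK j hj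
  refine hiG (mem_of_isExtent hG fun l hl => (hr.zero_iff i l).1 (le_antisymm ?_ (hr.nonneg i l)))
  have := nonneg_of_mem_coneOn (fun i _ => hr.nonneg i l) hmem
  rw [map_sub, (hx l).2.2 hl, map_smul, smul_eq_mul] at this
  by_contra! hcon
  have := mul_pos hε hcon
  linarith

variable {u : I → W} {f : J → Module.Dual ℝ W}

/-- Along a chain of faces, the dimension in any other realization of the zero pattern grows at
least as fast as in the cone. -/
theorem Realizes.finrank_add_le_finrank_add [Finite I] [Finite J]
    [FiniteDimensional ℝ W] (hr : Realizes R a h)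
    (hc : ∀ x, (∀ j, 0 ≤ h j x) → x ∈ coneOn a Set.univ)
    (hu : ∀ i j, f j (u i) = 0 ↔ R i j) {F G : Set I} (hF : Order.IsExtent R F)
    (hG : Order.IsExtent R G) (hGF : G ⊆ F) :
    Module.finrank ℝ (Submodule.span ℝ (a '' F)) + Module.finrank ℝ (Submodule.span ℝ (u '' G)) ≤
      Module.finrank ℝ (Submodule.span ℝ (u '' F)) +
        Module.finrank ℝ (Submodule.span ℝ (a '' G)) := by
  induction hn : Module.finrank ℝ (Submodule.span ℝ (a '' F)) generalizing F with
  | zero =>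
    by_cases hFG : F ⊆ G
    · rw [hFG.antisymm hGF] at hn ⊢; omega
    · obtain ⟨i, hi, hiG⟩ := Set.not_subset.1 hFG
      obtain ⟨j, hj, -, -⟩ := hr.exists_facetsOf hc hF hG hGF hi hiG
      have := hj.2
      omega
  | succ k ih =>
    by_cases hFG : F ⊆ G
    · rw [hFG.antisymm hGF] at hn ⊢; omega
    · obtain ⟨i, hi, hiG⟩ := Set.not_subset.1 hFG
      obtain ⟨j, hj, hGj, hij⟩ := hr.exists_facetsOf hc hF hG hGF hi hiG
      have h1 := ih (isExtent_inter_column hF j) (fun i' hi' => ⟨hGF hi', hGj i' hi'⟩)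
        (by have := hj.2; omega)
      have h2 : Module.finrank ℝ (Submodule.span ℝ (u '' (F ∩ {i | R i j}))) + 1 ≤
          Module.finrank ℝ (Submodule.span ℝ (u '' F)) := by
        rw [← Submodule.finrank_sup_span_singleton (v := u i) fun hmem => hij ((hu i j).1
          (eq_zero_of_mem_span (fun i' hi' => (hu i' j).2 hi'.2) hmem))]
        refine Submodule.finrank_mono (sup_le (span_image_mono Set.inter_subset_left) ?_)
        rw [Submodule.span_singleton_le_iff_mem]
        exact mem_span_image hi
      omega

/-- A realization of the zero pattern of a cone spans a space of at least the same dimension. -/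
theorem Realizes.finrank_le_finrank [Finite I] [Finite J]
    [FiniteDimensional ℝ W] (hr : Realizes R a h)
    (hc : ∀ x, (∀ j, 0 ≤ h j x) → x ∈ coneOn a Set.univ) (hempty : Order.IsExtent R ∅)
    (hu : ∀ i j, f j (u i) = 0 ↔ R i j) :
    Module.finrank ℝ (Submodule.span ℝ (Set.range a)) ≤
      Module.finrank ℝ (Submodule.span ℝ (Set.range u)) := by
  have h1 := hr.finrank_add_le_finrank_add hc hu .univ hempty (Set.empty_subset _)
  rw [Set.image_univ, Set.image_univ] at h1
  rw [Set.image_empty, Set.image_empty, Submodule.span_empty, Submodule.span_empty, finrank_bot,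
    finrank_bot] at h1
  exact h1

/-- In a realization of the zero pattern of a cone in the minimal dimension, all faces have the
same dimension as in the cone. -/
theorem Realizes.finrank_eq_finrank [Finite I] [Finite J]
    [FiniteDimensional ℝ W] (hr : Realizes R a h)
    (hc : ∀ x, (∀ j, 0 ≤ h j x) → x ∈ coneOn a Set.univ) (hempty : Order.IsExtent R ∅)
    (hu : ∀ i j, f j (u i) = 0 ↔ R i j) (hdim : Module.finrank ℝ W ≤ Module.finrank ℝ V)
    (hspan : Submodule.span ℝ (Set.range a) = ⊤) {F : Set I} (hF : Order.IsExtent R F) :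
    Module.finrank ℝ (Submodule.span ℝ (u '' F)) =
      Module.finrank ℝ (Submodule.span ℝ (a '' F)) := by
  have h1 := hr.finrank_add_le_finrank_add hc hu hF hempty (Set.empty_subset _)
  have h2 := hr.finrank_add_le_finrank_add hc hu .univ hF (Set.subset_univ _)
  have h3 := Submodule.finrank_le (Submodule.span ℝ (u '' Set.univ))
  rw [Set.image_univ, hspan, finrank_top] at h2
  rw [Set.image_empty, Set.image_empty, Submodule.span_empty, Submodule.span_empty, finrank_bot,
    finrank_bot] at h1
  omega

/-- The step of codimension one that underlies the comparison of two realizations: if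
`F ∩ {i | R i j}` is a facet of `F` and `i` is a generator of `F` outside it, the span of `F` is
obtained from that of the facet by adding the generator `i`. -/
theorem exists_eq_add_smul [FiniteDimensional ℝ W] (hu : ∀ i j, f j (u i) = 0 ↔ R i j)
    {F : Set I} {j : J} {i : I} (hi : i ∈ F) (hij : ¬ R i j)
    (hj : Module.finrank ℝ (Submodule.span ℝ (u '' (F ∩ {i | R i j}))) + 1 =
      Module.finrank ℝ (Submodule.span ℝ (u '' F))) {y : W}
    (hy : y ∈ Submodule.span ℝ (u '' F)) :
    ∃ w ∈ Submodule.span ℝ (u '' (F ∩ {i | R i j})), ∃ s : ℝ, y = w + s • u i := by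
  have hle : Submodule.span ℝ (u '' (F ∩ {i | R i j})) ⊔ Submodule.span ℝ {u i} ≤
      Submodule.span ℝ (u '' F) := by
    refine sup_le (span_image_mono Set.inter_subset_left) ?_
    rw [Submodule.span_singleton_le_iff_mem]
    exact mem_span_image hi
  have heq := Submodule.eq_of_le_of_finrank_le hle (by
    rw [Submodule.finrank_sup_span_singleton fun hmem => hij ((hu i j).1
          (eq_zero_of_mem_span (fun i' hi' => (hu i' j).2 hi'.2) hmem)), hj])
  rw [← heq, Submodule.mem_sup] at hy
  obtain ⟨w, hw, z, hz, rfl⟩ := hy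
  obtain ⟨s, rfl⟩ := Submodule.mem_span_singleton.1 hz
  exact ⟨w, hw, s, rfl⟩

/-- In a realization of the pattern in the minimal dimension, the facets of each face cut out the
cone over the face. -/
theorem Realizes.cutsOut_of_realizes [Finite I] [Finite J]
    [FiniteDimensional ℝ W] (hr : Realizes R a h)
    (hc : ∀ x, (∀ j, 0 ≤ h j x) → x ∈ coneOn a Set.univ) (hempty : Order.IsExtent R ∅)
    (hu : Realizes R u f) (hdim : Module.finrank ℝ W ≤ Module.finrank ℝ V)
    (hspan : Submodule.span ℝ (Set.range a) = ⊤) {F : Set I} (hF : Order.IsExtent R F) :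
    CutsOut u f F (facetsOf R a F) := by
  have hfr : ∀ {F : Set I}, Order.IsExtent R F → _ :=
    hr.finrank_eq_finrank hc hempty hu.zero_iff hdim hspan
  have hcodim : ∀ {F : Set I}, Order.IsExtent R F → ∀ {j}, j ∈ facetsOf R a F →
      Module.finrank ℝ (Submodule.span ℝ (u '' (F ∩ {i | R i j}))) + 1 =
        Module.finrank ℝ (Submodule.span ℝ (u '' F)) := by
    intro F hF j hj
    rw [hfr hF, hfr (isExtent_inter_column hF j)]
    exact hj.2
  induction hn : Module.finrank ℝ (Submodule.span ℝ (a '' F)) using Nat.strong_induction_on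
    generalizing F with
  | _ n ih =>
  intro x hx hxn
  rcases F.eq_empty_or_nonempty with rfl | ⟨i, hi⟩
  · simp only [Set.image_empty, Submodule.span_empty, Submodule.mem_bot] at hx
    rw [hx]
    exact zero_mem _
  -- subtract the largest multiple of `u i` that keeps all facet inequalities of `F` valid
  obtain ⟨j₁, hj₁, -, hij₁⟩ := hr.exists_facetsOf hc hF hempty (Set.empty_subset _) hi (by simp)
  obtain ⟨j, ⟨hj, hij⟩, hjmin⟩ := (Set.toFinite {j | j ∈ facetsOf R a F ∧ ¬ R i j}).exists_minimalFor
    (fun j => f j x / f j (u i)) _ ⟨j₁, hj₁, hij₁⟩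
  have hpos : ∀ {i : I} {l : J}, ¬ R i l → 0 < f l (u i) := fun {i l} hl =>
    lt_of_le_of_ne (hu.nonneg i l) fun h0 => hl ((hu.zero_iff i l).1 h0.symm)
  set t := f j x / f j (u i) with ht
  have ht0 : 0 ≤ t := div_nonneg (hxn j hj) (hu.nonneg i j)
  set y := x - t • u i with hy
  have hyF : y ∈ Submodule.span ℝ (u '' F) :=
    sub_mem hx (Submodule.smul_mem _ _ (mem_span_image hi))
  have hyn : ∀ l ∈ facetsOf R a F, 0 ≤ f l y := by
    intro l hl
    rw [hy, map_sub, map_smul, smul_eq_mul, sub_nonneg]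
    by_cases hil : R i l
    · rw [(hu.zero_iff i l).2 hil, mul_zero]; exact hxn l hl
    · rw [← le_div_iff₀ (hpos hil)]
      rcases le_total t (f l x / f l (u i)) with h1 | h1
      · exact h1
      · exact hjmin ⟨hl, hil⟩ h1
  have hyj : f j y = 0 := by
    rw [hy, map_sub, map_smul, smul_eq_mul, ht, div_mul_cancel₀ _ (hpos hij).ne', sub_self]
  have hyF' : y ∈ Submodule.span ℝ (u '' (F ∩ {i | R i j})) := by
    obtain ⟨w, hw, s, hws⟩ := exists_eq_add_smul hu.zero_iff hi hij (hcodim hF hj) hyF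
    have hw0 : f j w = 0 := eq_zero_of_mem_span (fun i' hi' => (hu.zero_iff i' j).2 hi'.2) hw
    rw [hws, map_add, hw0, zero_add, map_smul, smul_eq_mul] at hyj
    rcases mul_eq_zero.1 hyj with h0 | h0
    · rw [hws, h0, zero_smul, add_zero]; exact hw
    · exact absurd h0 (hpos hij).ne'
  have hF' := isExtent_inter_column hF j
  have hymem : y ∈ coneOn u (F ∩ {i | R i j}) := by
    refine ih _ (by have := hj.2; omega) hF' rfl y hyF' fun l hl => ?_
    -- the ridge cut out by `l` lies in a second facet `l'` of `F`, whose functional is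
    -- proportional to that of `l` on the span of the facet
    obtain ⟨i', hi', hil'⟩ := hl.1
    obtain ⟨l', hl', hsub, hil''⟩ := hr.exists_facetsOf hc hF (isExtent_inter_column hF' l)
      (fun _ hi => hi.1.1) hi'.1 (fun hmem => hil' hmem.2)
    obtain ⟨w, hw, s, hws⟩ := exists_eq_add_smul hu.zero_iff hi' hil' (hcodim hF' hl) hyF'
    have hw1 : f l w = 0 := eq_zero_of_mem_span (fun k hk => (hu.zero_iff k l).2 hk.2) hw
    have hw2 : f l' w = 0 :=
      eq_zero_of_mem_span (fun k hk => (hu.zero_iff k l').2 (hsub k hk)) hw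
    have h1 := hyn l' hl'
    rw [hws, map_add, map_smul, smul_eq_mul] at h1 ⊢
    rw [hw2, zero_add] at h1
    rw [hw1, zero_add]
    exact mul_nonneg (nonneg_of_mul_nonneg_left h1 (hpos hil'')) (hpos hil').le
  rw [← sub_add_cancel x (t • u i)]
  exact add_mem (coneOn_mono Set.inter_subset_left hymem) (smul_mem_coneOn ht0 (mem_coneOn hi))

/-- A realization of the pattern of a cone in the minimal dimension is again a pair of a cone and
its defining inequalities. -/
theorem Realizes.mem_coneOn_of_realizes [Finite I] [Finite J]
    [FiniteDimensional ℝ W] (hr : Realizes R a h)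
    (hc : ∀ x, (∀ j, 0 ≤ h j x) → x ∈ coneOn a Set.univ) (hempty : Order.IsExtent R ∅)
    (hu : Realizes R u f) (hdim : Module.finrank ℝ W ≤ Module.finrank ℝ V)
    (hspan : Submodule.span ℝ (Set.range a) = ⊤) (x : W) (hx : ∀ j, 0 ≤ f j x) :
    x ∈ coneOn u Set.univ := by
  refine hr.cutsOut_of_realizes hc hempty hu hdim hspan .univ x ?_ fun j _ => hx j
  have h1 := hr.finrank_eq_finrank hc hempty hu.zero_iff hdim hspan .univ
  rw [Set.image_univ (f := a), hspan, finrank_top] at h1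
  have htop : Submodule.span ℝ (u '' Set.univ) = ⊤ :=
    Submodule.eq_top_of_finrank_eq (le_antisymm (Submodule.finrank_le _) (h1 ▸ hdim))
  exact htop ▸ Submodule.mem_top

end Pattern

/-! ### Polytopes given both by points and by inequalities -/

section DoubleDescription

variable {E I J : Type*} [NormedAddCommGroup E] [InnerProductSpace ℝ E]

/-- The affine functional `x ↦ c - ⟪g, x⟫` on `E`, homogenized to a linear functional on
`ℝ × E`. -/
noncomputable def homFunctional (g : E) (c : ℝ) : Module.Dual ℝ (ℝ × E) :=
  c • LinearMap.fst ℝ ℝ E - (innerₗ E g).comp (LinearMap.snd ℝ ℝ E)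

@[simp]
theorem homFunctional_apply (g : E) (c : ℝ) (x : ℝ × E) :
    homFunctional g c x = c * x.1 - inner ℝ g x.2 := rfl

/-- The points `v i` homogenized to generators of a cone in `ℝ × E`. -/
def homPoint (v : I → E) (i : I) : ℝ × E := (1, v i)

/-- `P` is the convex hull of the points `v i` and also the solution set of the inequalities
`⟪g j, x⟫ ≤ c j`. -/
structure IsDoubleDescription (P : Set E) (v : I → E) (g : J → E) (c : J → ℝ) : Prop where
  eq_convexHull : P = convexHull ℝ (Set.range v)
  eq_setOf : P = {x | ∀ j, inner ℝ (g j) x ≤ c j}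

/-- The incidence relation between points and inequalities. -/
def incidence (v : I → E) (g : J → E) (c : J → ℝ) (i : I) (j : J) : Prop :=
  inner ℝ (g j) (v i) = c j

theorem exists_weights_of_mem_coneOn [Fintype I] {v : I → E} {x : E}
    (hx : ((1, x) : ℝ × E) ∈ coneOn (homPoint v) Set.univ) :
    ∃ w : I → ℝ, (∀ i, 0 ≤ w i) ∧ ∑ i, w i = 1 ∧ ∑ i, w i • v i = x := by
  rw [coneOn, Set.image_univ, PointedCone.hull, Submodule.mem_span_range_iff_exists_fun] at hx
  obtain ⟨w, hw⟩ := hx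
  have h1 := congrArg Prod.fst hw
  have h2 := congrArg Prod.snd hw
  rw [Prod.fst_sum] at h1
  rw [Prod.snd_sum] at h2
  refine ⟨fun i => w i, fun i => (w i).2, ?_, h2⟩
  refine Eq.trans (Finset.sum_congr rfl fun i _ => ?_) h1
  exact (mul_one (w i : ℝ)).symm

theorem homPoint_mem_coneOn_iff [Finite I] {v : I → E} {x : E} :
    ((1, x) : ℝ × E) ∈ coneOn (homPoint v) Set.univ ↔ x ∈ convexHull ℝ (Set.range v) := by
  have := Fintype.ofFinite I
  refine ⟨fun hx => ?_, fun hx => ?_⟩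
  · obtain ⟨w, hw0, hw1, rfl⟩ := exists_weights_of_mem_coneOn hx
    exact (convex_convexHull ℝ _).sum_mem (fun i _ => hw0 i) hw1
      fun i _ => subset_convexHull ℝ _ (Set.mem_range_self i)
  · have hsub : Set.range v ⊆ {x | ((1, x) : ℝ × E) ∈ coneOn (homPoint v) Set.univ} := by
      rintro _ ⟨i, rfl⟩
      exact mem_coneOn (a := homPoint v) (Set.mem_univ i)
    refine convexHull_min hsub ?_ hx
    intro x hx y hy s t hs ht hst
    have := add_mem (smul_mem_coneOn hs hx) (smul_mem_coneOn ht hy)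
    simpa [hst] using this

theorem exists_weights_of_mem_convexHull_range [Fintype I] {v : I → E} {x : E}
    (hx : x ∈ convexHull ℝ (Set.range v)) :
    ∃ w : I → ℝ, (∀ i, 0 ≤ w i) ∧ ∑ i, w i = 1 ∧ ∑ i, w i • v i = x :=
  exists_weights_of_mem_coneOn (homPoint_mem_coneOn_iff.2 hx)

theorem span_homPoint_eq_top {v : I → E} (hI : Nonempty I)
    (hv : affineSpan ℝ (Set.range v) = ⊤) : Submodule.span ℝ (Set.range (homPoint v)) = ⊤ := by
  set S := Submodule.span ℝ (Set.range (homPoint v)) with hS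
  have hvS : ∀ i, ((1, v i) : ℝ × E) ∈ S := fun i => Submodule.subset_span ⟨i, rfl⟩
  have hdir : vectorSpan ℝ (Set.range v) ≤ S.comap (LinearMap.inr ℝ ℝ E) := by
    rw [vectorSpan_def, Submodule.span_le]
    rintro _ ⟨_, ⟨i, rfl⟩, _, ⟨j, rfl⟩, rfl⟩
    simpa using sub_mem (hvS i) (hvS j)
  rw [← direction_affineSpan, hv, AffineSubspace.direction_top] at hdir
  rw [eq_top_iff]
  rintro ⟨t, x⟩ -
  obtain ⟨i⟩ := hI
  have h1 : ((0, x - t • v i) : ℝ × E) ∈ S := hdir (x := x - t • v i) trivial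
  simpa using add_mem h1 (S.smul_mem t (hvS i))

theorem affineSpan_eq_top_of_span_homPoint [Finite I] {v : I → E}
    (hv : Submodule.span ℝ (Set.range (homPoint v)) = ⊤) :
    affineSpan ℝ (Set.range v) = ⊤ := by
  have := Fintype.ofFinite I
  rw [eq_top_iff]
  intro x _
  have hx : ((1, x) : ℝ × E) ∈ Submodule.span ℝ (Set.range (homPoint v)) := hv ▸ trivial
  rw [Submodule.mem_span_range_iff_exists_fun] at hx
  obtain ⟨w, hw⟩ := hx
  have h1 : ∑ i, w i = 1 := by
    have := congrArg Prod.fst hw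
    rw [Prod.fst_sum] at this
    simpa [homPoint] using this
  have h2 : ∑ i, w i • v i = x := by
    have := congrArg Prod.snd hw
    rw [Prod.snd_sum] at this
    simpa [homPoint] using this
  have h3 := affineCombination_mem_affineSpan h1 v
  rwa [Finset.affineCombination_eq_linear_combination _ _ _ h1, h2] at h3

/-- A face of a polytope is contained in another one if its generating points are. -/
theorem exposed_subset_of_eq_convexHull [Finite I] {P : Set E} {v : I → E}
    (hP : P = convexHull ℝ (Set.range v)) {F G : Set E}
    (hF : IsExposed ℝ P F) (hG : IsExposed ℝ P G) (h : ∀ i, v i ∈ F → v i ∈ G) : F ⊆ G := by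
  have := Fintype.ofFinite I
  have hv : ∀ i, v i ∈ P := fun i => hP ▸ subset_convexHull ℝ _ (Set.mem_range_self i)
  intro x hx
  obtain ⟨l, rfl⟩ := hF ⟨x, hx⟩
  obtain ⟨w, hw0, hw1, hwx⟩ := exists_weights_of_mem_convexHull_range (hP ▸ hx.1)
  have hconv : Convex ℝ G := hG.convex (hP ▸ convex_convexHull ℝ _)
  have hl : ∑ i, w i * (l x - l (v i)) = 0 := by
    simp only [mul_sub, Finset.sum_sub_distrib, ← Finset.sum_mul, hw1]
    rw [← hwx]
    simp
  rw [Finset.sum_eq_zero_iff_of_nonneg fun i _ =>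
    mul_nonneg (hw0 i) (sub_nonneg.2 (hx.2 _ (hv i)))] at hl
  -- only points of the face carry weight
  have hmem : ∀ i, w i ≠ 0 → v i ∈ G := fun i hi => h i ⟨hv i, fun y hy => by
    have := (mul_eq_zero.1 (hl i (Finset.mem_univ i))).resolve_left hi
    rw [← sub_eq_zero.1 this]
    exact hx.2 y hy⟩
  classical
  have hs0 : ∑ i with w i ≠ 0, w i = 1 := by rw [Finset.sum_filter_ne_zero, hw1]
  have hs1 : ∑ i with w i ≠ 0, w i • v i = x := by
    rw [← hwx, Finset.sum_filter]
    refine Finset.sum_congr rfl fun i _ => ?_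
    by_cases hi : w i = 0 <;> simp [hi]
  rw [← hs1]
  exact hconv.sum_mem (fun i _ => hw0 i) hs0 fun i hi => hmem i (Finset.mem_filter.1 hi).2

namespace IsDoubleDescription

variable {P : Set E} {v : I → E} {g : J → E} {c : J → ℝ}

theorem point_mem (hP : IsDoubleDescription P v g c) (i : I) : v i ∈ P :=
  hP.eq_convexHull ▸ subset_convexHull ℝ _ (Set.mem_range_self i)

theorem inner_le (hP : IsDoubleDescription P v g c) {x : E} (hx : x ∈ P) (j : J) :
    inner ℝ (g j) x ≤ c j := by
  rw [hP.eq_setOf] at hx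
  exact hx j

theorem isBounded [Finite I] (hP : IsDoubleDescription P v g c) : Bornology.IsBounded P := by
  rw [hP.eq_convexHull, isBounded_convexHull]
  exact (Set.finite_range v).isBounded

theorem span_homPoint_eq_top (hP : IsDoubleDescription P v g c) (hne : P.Nonempty)
    (hspan : affineSpan ℝ P = ⊤) : Submodule.span ℝ (Set.range (homPoint v)) = ⊤ := by
  rw [hP.eq_convexHull] at hne hspan
  rw [convexHull_nonempty_iff, Set.range_nonempty_iff_nonempty] at hne
  rw [affineSpan_convexHull] at hspan
  exact Inscribability.span_homPoint_eq_top hne hspan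

/-- A bounded polyhedron has no recession directions. -/
theorem eq_zero_of_inner_nonpos [Finite I] (hP : IsDoubleDescription P v g c) (hne : P.Nonempty)
    {w : E} (hw : ∀ j, inner ℝ (g j) w ≤ 0) : w = 0 := by
  obtain ⟨p, hp⟩ := hne
  obtain ⟨C, hC⟩ := hP.isBounded.exists_norm_le
  by_contra h0
  have hpos := norm_pos_iff.2 h0
  have hray : ∀ t : ℝ, 0 ≤ t → p + t • w ∈ P := by
    intro t ht
    rw [hP.eq_setOf]
    intro j
    rw [inner_add_right, inner_smul_right]
    have := mul_nonneg ht (neg_nonneg.2 (hw j))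
    linarith [hP.inner_le hp j]
  have hC0 : 0 ≤ C := (norm_nonneg p).trans (hC p hp)
  have h1 := hC _ (hray ((2 * C + 1) / ‖w‖) (by positivity))
  have h2 : ‖((2 * C + 1) / ‖w‖) • w‖ = 2 * C + 1 := by
    rw [norm_smul, Real.norm_of_nonneg (by positivity), div_mul_cancel₀ _ hpos.ne']
  have h3 := norm_sub_le (p + ((2 * C + 1) / ‖w‖) • w) p
  rw [add_sub_cancel_left, h2] at h3
  linarith [hC p hp]

theorem realizes (hP : IsDoubleDescription P v g c) :
    Realizes (incidence v g c) (homPoint v) (fun j => homFunctional (g j) (c j)) where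
  nonneg i j := by
    have := hP.inner_le (hP.point_mem i) j
    simp [homPoint, this]
  zero_iff i j := by
    simp [homPoint, incidence, sub_eq_zero, eq_comm]

/-- The inequalities of a polytope, homogenized, cut out the cone over the polytope. -/
theorem mem_coneOn [Finite I] (hP : IsDoubleDescription P v g c) (hnt : P.Nontrivial) (x : ℝ × E)
    (hx : ∀ j, 0 ≤ homFunctional (g j) (c j) x) : x ∈ coneOn (homPoint v) Set.univ := by
  obtain ⟨t, x⟩ := x
  simp only [homFunctional_apply, sub_nonneg] at hx
  rcases lt_trichotomy t 0 with ht | rfl | ht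
  · -- here `x / t` would violate or touch every inequality, so `P` would be a single point
    have hy : ∀ p ∈ P, p - t⁻¹ • x = 0 := fun p hp =>
      hP.eq_zero_of_inner_nonpos hnt.nonempty fun j => by
        rw [inner_sub_right, inner_smul_right]
        have h1 : t⁻¹ * (c j * t) ≤ t⁻¹ * inner ℝ (g j) x :=
          mul_le_mul_of_nonpos_left (hx j) (inv_nonpos.2 ht.le)
        rw [mul_comm (c j), inv_mul_cancel_left₀ ht.ne] at h1
        linarith [hP.inner_le hp j]
    obtain ⟨p, hp, q, hq, hpq⟩ := hnt
    exact absurd ((sub_eq_zero.1 (hy p hp)).trans (sub_eq_zero.1 (hy q hq)).symm) hpq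
  · have h0 : x = 0 := hP.eq_zero_of_inner_nonpos hnt.nonempty fun j => by simpa using hx j
    rw [h0]
    exact zero_mem _
  · have hmem : t⁻¹ • x ∈ P := by
      rw [hP.eq_setOf]
      intro j
      rw [inner_smul_right, inv_mul_le_iff₀ ht, mul_comm]
      exact hx j
    rw [hP.eq_convexHull, ← homPoint_mem_coneOn_iff] at hmem
    simpa [ht.ne'] using smul_mem_coneOn ht.le hmem

theorem isExtent_empty [Finite I] (hP : IsDoubleDescription P v g c) (hnt : P.Nontrivial) :
    Order.IsExtent (incidence v g c) ∅ := by
  refine ⟨Set.univ, Set.eq_empty_of_forall_notMem fun i hi => ?_⟩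
  have hy : ∀ p ∈ P, p - v i = 0 := fun p hp =>
    hP.eq_zero_of_inner_nonpos hnt.nonempty fun j => by
      rw [inner_sub_right, show inner ℝ (g j) (v i) = c j from hi (Set.mem_univ j)]
      linarith [hP.inner_le hp j]
  obtain ⟨p, hp, q, hq, hpq⟩ := hnt
  exact hpq ((sub_eq_zero.1 (hy p hp)).trans (sub_eq_zero.1 (hy q hq)).symm)

/-- The points on a face form a closed set of the incidence relation. -/
theorem isExtent_of_isExposed [Finite I] [Finite J] (hP : IsDoubleDescription P v g c)
    (hnt : P.Nontrivial) {F : Set E} (hF : IsExposed ℝ P F) :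
    Order.IsExtent (incidence v g c) {i | v i ∈ F} := by
  rcases F.eq_empty_or_nonempty with rfl | hne
  · simpa using hP.isExtent_empty hnt
  obtain ⟨l, rfl⟩ := hF hne
  obtain ⟨z, hz⟩ := hne
  rw [Order.isExtent_iff]
  refine (Set.Subset.antisymm (subset_lowerPolar_upperPolar _ _) fun i hi => ?_).symm
  refine ⟨hP.point_mem i, fun y hy => (hz.2 y hy).trans ?_⟩
  -- `x` is a point of the cone over the face on which only the inequalities of the face are tight;
  -- moving away from `v i` keeps it inside the cone over `P`
  obtain ⟨x, hx, hxj⟩ := hP.realizes.exists_interior_point {i | v i ∈ l.toExposed P}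
  obtain ⟨ε, hε, hεK⟩ := exists_pos_forall_add_mul_nonneg
    (fun j => homFunctional (g j) (c j) x) (fun j => -homFunctional (g j) (c j) (homPoint v i))
    Set.univ (fun j _ => (hxj j).1) fun j _ h0 => by
      rw [(hP.realizes.zero_iff i j).2 (hi fun i' hi' => (hxj j).2.1 h0 i' hi'), neg_zero]
  have hmem : x - ε • homPoint v i ∈ coneOn (homPoint v) Set.univ :=
    hP.mem_coneOn hnt _ fun j => by
      rw [map_sub, map_smul, smul_eq_mul]
      linarith [hεK j trivial]
  set f : Module.Dual ℝ (ℝ × E) := l z • LinearMap.fst ℝ ℝ E -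
    (l : E →ₗ[ℝ] ℝ).comp (LinearMap.snd ℝ ℝ E) with hf
  have hfv : ∀ i, f (homPoint v i) = l z - l (v i) := fun i => by simp [hf, homPoint]
  have h1 := nonneg_of_mem_coneOn (f := f)
    (fun i _ => by rw [hfv]; exact sub_nonneg.2 (hz.2 _ (hP.point_mem i))) hmem
  have h2 : f x = 0 := eq_zero_of_mem_span
    (fun i hi => by rw [hfv]; exact sub_eq_zero.2 (le_antisymm (hi.2 z hz.1) (hz.2 _ hi.1)))
    (coneOn_le_span hx)
  rw [map_sub, map_smul, smul_eq_mul, hfv, h2, zero_sub, Left.nonneg_neg_iff] at h1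
  exact sub_nonpos.1 (nonpos_of_mul_nonpos_right h1 hε)

/-- The points of `P` at which all inequalities in `K` are tight form a face. If there are
any, it is exposed by the sum of the corresponding functionals. -/
theorem isExposed_setOf_tight [Finite J] (hP : IsDoubleDescription P v g c) (K : Set J) :
    IsExposed ℝ P {x ∈ P | ∀ j ∈ K, inner ℝ (g j) x = c j} := by
  classical
  have := Fintype.ofFinite J
  rintro ⟨z, hz⟩
  refine ⟨∑ j with j ∈ K, innerSL ℝ (g j), ?_⟩
  have happ : ∀ x, (∑ j with j ∈ K, innerSL ℝ (g j)) x = ∑ j with j ∈ K, inner ℝ (g j) x :=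
    fun x => by simp
  ext x
  simp only [Set.mem_ofPred_eq, happ]
  refine and_congr_right fun hx => ⟨fun h y hy => Finset.sum_le_sum fun j hj => ?_, fun h => ?_⟩
  · rw [h j (Finset.mem_filter.1 hj).2]
    exact hP.inner_le hy j
  · have h1 := h z hz.1
    have h2 : ∑ j with j ∈ K, inner ℝ (g j) z = ∑ j with j ∈ K, c j :=
      Finset.sum_congr rfl fun j hj => hz.2 j (Finset.mem_filter.1 hj).2
    have h3 := (Finset.sum_eq_sum_iff_of_le fun j _ => hP.inner_le hx j).1
      (le_antisymm (Finset.sum_le_sum fun j _ => hP.inner_le hx j) (h2 ▸ h1))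
    exact fun j hj => h3 j (by simpa using hj)

end IsDoubleDescription

end DoubleDescription

section FaceLattice

variable {d : ℕ} {I J : Type*} [Finite I] [Finite J]
  {P Q : Set (EuclideanSpace ℝ (Fin d))} {v : I → EuclideanSpace ℝ (Fin d)}
  {g : J → EuclideanSpace ℝ (Fin d)} {c : J → ℝ}

/-- The face lattice of a polytope is the concept lattice of its incidence relation. -/
theorem IsDoubleDescription.nonempty_faceLattice_orderIso (hP : IsDoubleDescription P v g c)
    (hnt : P.Nontrivial) : Nonempty (FaceLattice P ≃o Concept I J (incidence v g c)) := by
  let φ : FaceLattice P ↪o Concept I J (incidence v g c) :=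
    OrderEmbedding.ofMapLEIff
      (fun F => Concept.ofIsExtent _ _ (hP.isExtent_of_isExposed hnt F.2)) fun F G =>
        ⟨fun h => exposed_subset_of_eq_convexHull hP.eq_convexHull F.2 G.2 fun i hi => h hi,
          fun h i hi => h hi⟩
  refine ⟨RelIso.ofSurjective φ fun C => ?_⟩
  have hC := C.isExtent_extent
  rcases C.extent.eq_empty_or_nonempty with he | ⟨i, hi⟩
  · refine ⟨⟨∅, isExposed_empty⟩, Concept.ext ?_⟩
    rw [he]
    ext i
    exact Iff.rfl
  · refine ⟨⟨_, hP.isExposed_setOf_tight C.intent⟩, Concept.ext ?_⟩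
    ext i'
    have : i' ∈ C.extent ↔ ∀ j ∈ C.intent, incidence v g c i' j := by
      rw [← C.lowerPolar_intent]; exact Iff.rfl
    rw [this]
    exact ⟨fun h => h.2, fun h => ⟨hP.point_mem i', h⟩⟩

theorem IsDPolytope.nontrivial (hd : 1 ≤ d) (hP : IsDPolytope P) : P.Nontrivial := by
  by_contra hcon
  rw [Set.not_nontrivial_iff] at hcon
  have : NeZero d := ⟨by omega⟩
  have h1 := congrArg AffineSubspace.direction hP.2
  rw [direction_affineSpan, vectorSpan_of_subsingleton ℝ hcon,
    AffineSubspace.direction_top] at h1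
  exact bot_ne_top h1

theorem IsDPolytope.isCompact (hP : IsDPolytope P) : IsCompact P := by
  obtain ⟨⟨T, rfl⟩, -⟩ := hP
  exact T.finite_toSet.isCompact_convexHull ℝ

theorem IsDPolytope.convex (hP : IsDPolytope P) : Convex ℝ P := by
  obtain ⟨⟨T, rfl⟩, -⟩ := hP
  exact convex_convexHull ℝ _

theorem IsDPolytope.finite_extremePoints (hP : IsDPolytope P) :
    (P.extremePoints ℝ).Finite := by
  obtain ⟨⟨T, rfl⟩, -⟩ := hP
  exact T.finite_toSet.subset extremePoints_convexHull_subset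

theorem IsDPolytope.convexHull_extremePoints (hP : IsDPolytope P) :
    convexHull ℝ (P.extremePoints ℝ) = P := by
  rw [← (hP.finite_extremePoints.isClosed_convexHull ℝ).closure_eq]
  exact closure_convexHull_extremePoints hP.isCompact hP.convex

/-- A realization of the zero pattern of a `d`-polytope by points and inequalities in `ℝ^d` is a
double description of a combinatorially equivalent polytope. -/
theorem IsDoubleDescription.exists_combEquiv (hd : 1 ≤ d) (hPd : IsDPolytope P)
    (hP : IsDoubleDescription P v g c) {p : I → EuclideanSpace ℝ (Fin d)}
    {q : J → EuclideanSpace ℝ (Fin d)} {b : J → ℝ} (hn : ∀ i j, inner ℝ (q j) (p i) ≤ b j)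
    (hz : ∀ i j, inner ℝ (q j) (p i) = b j ↔ inner ℝ (g j) (v i) = c j) :
    IsDPolytope (convexHull ℝ (Set.range p)) ∧ CombEquiv P (convexHull ℝ (Set.range p)) := by
  have hnt := hPd.nontrivial hd
  have hspan := hP.span_homPoint_eq_top hnt.nonempty hPd.2
  have hu : Realizes (incidence v g c) (homPoint p) (fun j => homFunctional (q j) (b j)) :=
    { nonneg := fun i j => by simpa [homPoint] using hn i j
      zero_iff := fun i j => by
        simpa [homPoint, sub_eq_zero, incidence, @eq_comm _ (b j)] using hz i j }
  have hQ : IsDoubleDescription (convexHull ℝ (Set.range p)) p q b := by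
    refine ⟨rfl, Set.Subset.antisymm (convexHull_min ?_ ?_) fun x hx => ?_⟩
    · rintro _ ⟨i, rfl⟩ j
      exact hn i j
    · simp only [Set.ofPred_forall]
      exact convex_iInter fun j => convex_halfSpace_le (innerₗ _ (q j)).isLinear _
    · rw [← homPoint_mem_coneOn_iff]
      refine hP.realizes.mem_coneOn_of_realizes (hP.mem_coneOn hnt) (hP.isExtent_empty hnt) hu
        le_rfl hspan _ fun j => ?_
      simpa using hx j
  have hQd : IsDPolytope (convexHull ℝ (Set.range p)) := by
    refine ⟨⟨(Set.finite_range p).toFinset, by simp⟩, ?_⟩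
    rw [affineSpan_convexHull]
    refine affineSpan_eq_top_of_span_homPoint
      (Submodule.eq_top_of_finrank_eq (le_antisymm (Submodule.finrank_le _) ?_))
    rw [← finrank_top ℝ (ℝ × EuclideanSpace ℝ (Fin d)), ← hspan]
    exact hP.realizes.finrank_le_finrank (hP.mem_coneOn hnt) (hP.isExtent_empty hnt) hu.zero_iff
  refine ⟨hQd, ?_⟩
  obtain ⟨e⟩ := hP.nonempty_faceLattice_orderIso hnt
  obtain ⟨e'⟩ := hQ.nonempty_faceLattice_orderIso (hQd.nontrivial hd)
  have hR : incidence p q b = incidence v g c := by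
    ext i j
    exact hz i j
  rw [hR] at e'
  exact ⟨e.trans e'.symm⟩

end FaceLattice

/-! ### Vertices under isomorphisms of face lattices -/

section Vertices

variable {d : ℕ} {P Q : Set (EuclideanSpace ℝ (Fin d))}

/-- Vertices of a polytope are exposed. -/
theorem IsDPolytope.isExposed_singleton (hP : IsDPolytope P) {v : EuclideanSpace ℝ (Fin d)}
    (hv : v ∈ P.extremePoints ℝ) : IsExposed ℝ P {v} := by
  have hsub : P.extremePoints ℝ \ {v} ⊆ P \ {v} :=
    Set.sdiff_subset_sdiff_left extremePoints_subset
  have hnot : v ∉ convexHull ℝ (P.extremePoints ℝ \ {v}) := fun hmem =>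
    (hP.convex.mem_extremePoints_iff_mem_sdiff_convexHull_sdiff.1 hv).2 (convexHull_mono hsub hmem)
  obtain ⟨l, b, hl, hb⟩ := geometric_hahn_banach_closed_point (convex_convexHull ℝ _)
    ((hP.finite_extremePoints.subset Set.sdiff_subset).isClosed_convexHull ℝ) hnot
  have hlt : ∀ w ∈ P.extremePoints ℝ, w ≠ v → l w < l v := fun w hw hne =>
    (hl w (subset_convexHull ℝ _ ⟨hw, hne⟩)).trans hb
  have hle : ∀ y ∈ P, l y ≤ l v := by
    have : P ⊆ {y | l y ≤ l v} := by
      rw [← hP.convexHull_extremePoints]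
      refine convexHull_min (fun w hw => ?_)
        (convex_halfSpace_le (l : EuclideanSpace ℝ (Fin d) →ₗ[ℝ] ℝ).isLinear _)
      by_cases hne : w = v
      · rw [hne]; exact le_refl (l v)
      · exact (hlt w hw hne).le
    exact this
  have hG : IsExposed ℝ P (l.toExposed P) := ContinuousLinearMap.toExposed.isExposed
  have hext : (l.toExposed P).extremePoints ℝ ⊆ {v} := by
    intro w hw
    by_contra hne
    have h1 := hlt w (hG.isExtreme.extremePoints_subset_extremePoints hw) hne
    exact absurd ((extremePoints_subset hw).2 v hv.1) (not_le.2 h1)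
  suffices h : l.toExposed P = {v} from h ▸ hG
  refine Set.Subset.antisymm ?_ (Set.singleton_subset_iff.2 ⟨hv.1, hle⟩)
  rw [← closure_convexHull_extremePoints (hG.isCompact hP.isCompact) (hG.convex hP.convex)]
  refine closure_minimal (convexHull_min hext (convex_singleton v)) isClosed_singleton

theorem IsDPolytope.exists_mem_extremePoints (hP : IsDPolytope P)
    {F : Set (EuclideanSpace ℝ (Fin d))} (hF : IsExposed ℝ P F) (hne : F.Nonempty) :
    ∃ v ∈ P.extremePoints ℝ, v ∈ F := by
  obtain ⟨v, hv⟩ := (hF.isCompact hP.isCompact).extremePoints_nonempty hne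
  exact ⟨v, hF.isExtreme.extremePoints_subset_extremePoints hv, extremePoints_subset hv⟩

theorem nonempty_of_orderIso (φ : FaceLattice P ≃o FaceLattice Q) {F : FaceLattice P}
    (hF : F.1.Nonempty) : (φ F).1.Nonempty := by
  rw [Set.nonempty_iff_ne_empty]
  intro h0
  have h1 : φ F ≤ φ ⟨∅, isExposed_empty⟩ := by
    change (φ F).1 ⊆ _
    rw [h0]
    exact Set.empty_subset _
  obtain ⟨x, hx⟩ := hF
  exact φ.le_iff_le.1 h1 hx

/-- An isomorphism of face lattices maps vertices, the atoms, to vertices. -/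
theorem IsDPolytope.exists_vertex_of_orderIso (hP : IsDPolytope P) (hQ : IsDPolytope Q)
    (φ : FaceLattice P ≃o FaceLattice Q) {v : EuclideanSpace ℝ (Fin d)}
    (hv : v ∈ P.extremePoints ℝ) :
    ∃ w ∈ Q.extremePoints ℝ, ∀ F : FaceLattice P, v ∈ F.1 ↔ w ∈ (φ F).1 := by
  set A : FaceLattice P := ⟨{v}, hP.isExposed_singleton hv⟩ with hA
  obtain ⟨w, hw, hwA⟩ := hQ.exists_mem_extremePoints (φ A).2
    (nonempty_of_orderIso φ (Set.singleton_nonempty v))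
  set B : FaceLattice Q := ⟨{w}, hQ.isExposed_singleton hw⟩ with hB
  have hBA : B ≤ φ A := Set.singleton_subset_iff.2 hwA
  have hBA' : φ.symm B ≤ A := by rwa [← φ.le_iff_le, φ.apply_symm_apply]
  have hAB : A ≤ φ.symm B := by
    obtain ⟨x, hx⟩ := nonempty_of_orderIso φ.symm (F := B) (Set.singleton_nonempty w)
    have hxv : x = v := hBA' hx
    exact Set.singleton_subset_iff.2 (hxv ▸ hx)
  have hEq : φ A = B := by rw [hAB.antisymm hBA', φ.apply_symm_apply]
  refine ⟨w, hw, fun F => ?_⟩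
  have h1 : v ∈ F.1 ↔ A ≤ F := Set.singleton_subset_iff.symm
  have h2 : w ∈ (φ F).1 ↔ B ≤ φ F := Set.singleton_subset_iff.symm
  rw [h1, h2, ← hEq, φ.le_iff_le]

end Vertices

/-! ### Moving an interior point of a sphere to its center -/

section Recentering

variable {E : Type*} [NormedAddCommGroup E] [InnerProductSpace ℝ E]

/-- The projective transformation that preserves the unit sphere and moves the interior point `z`
to the origin, together with its action on affine functionals that are positive at `z`. In the
Lorentz model it is the boost that takes the multiple `s • (1, z)` of `(1, z)` in the unit
hyperboloid to `(1, 0)`. -/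
theorem exists_recentering {z : E} (hz : ‖z‖ < 1) :
    ∃ (T : E → E) (D : E → ℝ → E), (∀ w, ‖w‖ = 1 → ‖T w‖ = 1) ∧
      ∀ w g b, ‖w‖ = 1 → inner ℝ g z < b →
        ∃ t > 0, 1 - inner ℝ (D g b) (T w) = t * (b - inner ℝ g w) := by
  set N : ℝ := inner ℝ z z with hN
  have hN1 : N < 1 := by
    rw [hN, real_inner_self_eq_norm_sq]
    nlinarith [norm_nonneg z]
  set s : ℝ := (√(1 - N))⁻¹ with hs
  have hs0 : 0 < s := inv_pos.2 (Real.sqrt_pos.2 (sub_pos.2 hN1))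
  have hsN : s ^ 2 * N = s ^ 2 - 1 := by
    have : s ^ 2 * (1 - N) = 1 := by
      rw [hs, inv_pow, Real.sq_sqrt (sub_pos.2 hN1).le, inv_mul_cancel₀ (sub_pos.2 hN1).ne']
    linarith
  set k : ℝ := s ^ 2 / (1 + s) with hk
  have hks : k * (1 + s) = s ^ 2 := div_mul_cancel₀ _ (by positivity)
  have hkN : k * N = s - 1 := by
    have : (1 + s) * (k * N) = (1 + s) * (s - 1) := by linear_combination N * hks + hsN
    exact mul_left_cancel₀ (by positivity) this
  have hc : ∀ w : E, ‖w‖ = 1 → 0 < s * (1 - inner ℝ z w) := by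
    intro w hw
    have := real_inner_le_norm z w
    rw [hw, mul_one] at this
    exact mul_pos hs0 (by linarith)
  refine ⟨fun w => (s * (1 - inner ℝ z w))⁻¹ • (w + (k * inner ℝ z w - s) • z),
    fun g b => (s * (b - inner ℝ g z))⁻¹ • (g + (k * inner ℝ g z - b * s) • z),
    fun w hw => ?_, fun w g b hw hb => ?_⟩
  · have hsq : ‖w + (k * inner ℝ z w - s) • z‖ ^ 2 = (s * (1 - inner ℝ z w)) ^ 2 := by
      have hww : inner ℝ w w = (1 : ℝ) := by rw [real_inner_self_eq_norm_sq, hw, one_pow]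
      rw [← real_inner_self_eq_norm_sq, inner_add_left, inner_add_right, inner_add_right,
        inner_smul_left, inner_smul_left, inner_smul_right, inner_smul_right, hww,
        real_inner_comm z w, ← hN]
      simp only [conj_trivial]
      linear_combination (k * inner ℝ z w ^ 2 - 2 * inner ℝ z w * s) * hkN + hsN +
        inner ℝ z w ^ 2 * hks
    have hn : ‖w + (k * inner ℝ z w - s) • z‖ = s * (1 - inner ℝ z w) :=
      (sq_eq_sq₀ (norm_nonneg _) (hc w hw).le).1 hsq
    rw [norm_smul, hn, norm_inv, Real.norm_of_nonneg (hc w hw).le, inv_mul_cancel₀ (hc w hw).ne']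
  · have hb' : 0 < s * (b - inner ℝ g z) := mul_pos hs0 (sub_pos.2 hb)
    refine ⟨(s * (b - inner ℝ g z))⁻¹ * (s * (1 - inner ℝ z w))⁻¹,
      mul_pos (inv_pos.2 hb') (inv_pos.2 (hc w hw)), ?_⟩
    have hin : inner ℝ (g + (k * inner ℝ g z - b * s) • z) (w + (k * inner ℝ z w - s) • z) =
        s * (b - inner ℝ g z) * (s * (1 - inner ℝ z w)) - (b - inner ℝ g w) := by
      rw [inner_add_left, inner_add_right, inner_add_right, inner_smul_left, inner_smul_left,
        inner_smul_right, inner_smul_right, ← hN]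
      simp only [conj_trivial]
      linear_combination (k * inner ℝ g z * inner ℝ z w - inner ℝ g z * s -
        b * s * inner ℝ z w) * hkN + b * hsN + inner ℝ g z * inner ℝ z w * hks
    rw [inner_smul_left, inner_smul_right, hin]
    simp only [conj_trivial]
    generalize s * (b - inner ℝ g z) = α at hb'
    generalize hβ : s * (1 - inner ℝ z w) = β
    have h1 : β ≠ 0 := hβ ▸ (hc w hw).ne'
    have h2 := hb'.ne'
    field_simp
    ring

end Recentering

/-! ### Bordered matrices of point configurations -/

section Bordered

variable {d n m : ℕ}

/-- The matrix with entries `1 + ⟪x k, y l⟫`. -/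
noncomputable def onePlusInner {k l : Type*} (x : k → EuclideanSpace ℝ (Fin d))
    (y : l → EuclideanSpace ℝ (Fin d)) : Matrix k l ℝ :=
  Matrix.of fun i j => 1 + inner ℝ (x i) (y j)

/-- The bordered matrix of two point configurations `p`, `q` is the Gram matrix of the vectors
`(1, 0)`, `(1, p i)` and `(1, q j)`. -/
theorem bordered_onePlusInner_eq (p : Fin n → EuclideanSpace ℝ (Fin d))
    (q : Fin m → EuclideanSpace ℝ (Fin d)) :
    ∃ N : Matrix (Unit ⊕ Fin d) (Unit ⊕ (Fin n ⊕ Fin m)) ℝ,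
      bordered (onePlusInner p p) (onePlusInner p q) (onePlusInner q q) = N.conjTranspose * N := by
  let x : Unit ⊕ (Fin n ⊕ Fin m) → EuclideanSpace ℝ (Fin d) :=
    Sum.elim (fun _ => 0) (Sum.elim p q)
  let N : Matrix (Unit ⊕ Fin d) (Unit ⊕ (Fin n ⊕ Fin m)) ℝ :=
    Matrix.of (Sum.elim (fun _ _ => 1) fun r k => x k r)
  have hentry : ∀ k l, (N.conjTranspose * N) k l = 1 + inner ℝ (x k) (x l) := by
    intro k l
    simp [N, Matrix.mul_apply, PiLp.inner_apply, mul_comm]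
  refine ⟨N, ?_⟩
  ext k l
  rw [hentry]
  rcases k with k | k | k <;> rcases l with l | l | l <;>
    simp [bordered, x, onePlusInner, real_inner_comm]

theorem posSemidef_bordered_onePlusInner (p : Fin n → EuclideanSpace ℝ (Fin d))
    (q : Fin m → EuclideanSpace ℝ (Fin d)) :
    (bordered (onePlusInner p p) (onePlusInner p q) (onePlusInner q q)).PosSemidef := by
  obtain ⟨N, hN⟩ := bordered_onePlusInner_eq p q
  exact hN ▸ Matrix.posSemidef_conjTranspose_mul_self N

theorem rank_bordered_onePlusInner_le (p : Fin n → EuclideanSpace ℝ (Fin d))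
    (q : Fin m → EuclideanSpace ℝ (Fin d)) :
    (bordered (onePlusInner p p) (onePlusInner p q) (onePlusInner q q)).rank ≤ d + 1 := by
  obtain ⟨N, hN⟩ := bordered_onePlusInner_eq p q
  rw [hN, Matrix.rank_conjTranspose_mul_self]
  refine N.rank_le_card_height.trans ?_
  simp [add_comm]

open scoped MatrixOrder Matrix.Norms.L2Operator in
/-- Conversely, a positive semidefinite bordered matrix of rank `d + 1` comes from point
configurations in `ℝ^d`. -/
theorem exists_eq_one_add_inner {A : Matrix (Fin n) (Fin n) ℝ} {S : Matrix (Fin n) (Fin m) ℝ}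
    {B : Matrix (Fin m) (Fin m) ℝ} (hX : (bordered A S B).PosSemidef)
    (hrank : (bordered A S B).rank = d + 1) :
    ∃ (p : Fin n → EuclideanSpace ℝ (Fin d)) (q : Fin m → EuclideanSpace ℝ (Fin d)),
      (∀ i j, S i j = 1 + inner ℝ (p i) (q j)) ∧ ∀ i, A i i = 1 + ‖p i‖ ^ 2 := by
  let K := Unit ⊕ (Fin n ⊕ Fin m)
  obtain ⟨N, hN⟩ : ∃ N : Matrix K K ℝ, bordered A S B = N.conjTranspose * N := by
    classical
    exact CStarAlgebra.nonneg_iff_eq_star_mul_self.1 hX.nonneg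
  let b : K → EuclideanSpace ℝ K := fun k => WithLp.toLp 2 (N.col k)
  have hb : ∀ k l, inner ℝ (b k) (b l) = bordered A S B k l := by
    intro k l
    rw [hN]
    simp [b, Matrix.mul_apply, PiLp.inner_apply, mul_comm]
  let U : Submodule ℝ (EuclideanSpace ℝ K) := Submodule.span ℝ (Set.range b)
  have hU : Module.finrank ℝ U = d + 1 := by
    rw [← hrank, hN, Matrix.rank_conjTranspose_mul_self, Matrix.rank_eq_finrank_span_cols]
    have : U = (Submodule.span ℝ (Set.range N.col)).map
        (WithLp.linearEquiv 2 ℝ (K → ℝ)).symm.toLinearMap := by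
      rw [Submodule.map_span, ← Set.range_comp]
      rfl
    rw [this]
    exact LinearEquiv.finrank_map_eq _ _
  have : Fact (Module.finrank ℝ U = d + 1) := ⟨hU⟩
  let x : K → U := fun k => ⟨b k, Submodule.subset_span ⟨k, rfl⟩⟩
  have hx : ∀ k l, inner ℝ (x k) (x l) = bordered A S B k l := hb
  let e : U := x (Sum.inl ())
  have hee : inner ℝ e e = (1 : ℝ) := hx _ _
  have hek : ∀ k, inner ℝ e (x k) = (1 : ℝ) := by
    intro k
    refine (hx _ _).trans ?_
    rcases k with k | k | k <;> rfl
  have he : e ≠ 0 := by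
    intro h0
    rw [h0, inner_zero_left] at hee
    exact zero_ne_one hee
  -- the components of the Gram vectors orthogonal to the unit vector `e`
  have hperp : ∀ k, x k - e ∈ (Submodule.span ℝ {e})ᗮ := by
    intro k
    rw [Submodule.mem_orthogonal_singleton_iff_inner_right, inner_sub_right, hek, hee, sub_self]
  let o := OrthonormalBasis.fromOrthogonalSpanSingleton (𝕜 := ℝ) d he
  let y : K → EuclideanSpace ℝ (Fin d) := fun k => o.repr ⟨x k - e, hperp k⟩
  have hy : ∀ k l, inner ℝ (y k) (y l) = bordered A S B k l - 1 := by
    intro k l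
    have h1 : inner ℝ (y k) (y l) = inner ℝ (x k - e) (x l - e) := o.repr.inner_map_map _ _
    rw [h1, inner_sub_left, inner_sub_right, inner_sub_right, hx, hee, hek, real_inner_comm, hek]
    ring
  refine ⟨fun i => y (Sum.inr (Sum.inl i)), fun j => y (Sum.inr (Sum.inr j)), fun i j => ?_,
    fun i => ?_⟩
  · rw [hy]; simp [bordered]
  · rw [← real_inner_self_eq_norm_sq, hy]; simp [bordered]

end Bordered

/-! ### Facets, and the existence of slack matrices -/

section Facets

variable {d : ℕ} {P : Set (EuclideanSpace ℝ (Fin d))}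

theorem exists_inner_of_isExposed {F : Set (EuclideanSpace ℝ (Fin d))} (hF : IsExposed ℝ P F)
    (hne : F.Nonempty) : ∃ (g : EuclideanSpace ℝ (Fin d)) (c : ℝ),
      (∀ x ∈ P, inner ℝ g x ≤ c) ∧ F = {x ∈ P | inner ℝ g x = c} := by
  obtain ⟨l, rfl⟩ := hF hne
  obtain ⟨z, hz⟩ := hne
  have hl : ∀ x, inner ℝ ((InnerProductSpace.toDual ℝ _).symm l) x = l x := fun x =>
    InnerProductSpace.toDual_symm_apply
  refine ⟨(InnerProductSpace.toDual ℝ _).symm l, l z, fun x hx => by rw [hl]; exact hz.2 x hx, ?_⟩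
  ext x
  simp only [hl, Set.mem_ofPred_eq]
  exact and_congr_right fun hx =>
    ⟨fun h => le_antisymm (hz.2 x hx) (h z hz.1), fun h y hy => h ▸ hz.2 y hy⟩

theorem IsDPolytope.not_isFacet_self (hP : IsDPolytope P) : ¬ IsFacet P P := by
  rintro ⟨-, -, h⟩
  rw [← direction_affineSpan, hP.2, AffineSubspace.direction_top, finrank_top,
    finrank_euclideanSpace_fin] at h
  omega

theorem IsDPolytope.exists_inner_lt (hP : IsDPolytope P) {g : EuclideanSpace ℝ (Fin d)} {c : ℝ}
    (hle : ∀ x ∈ P, inner ℝ g x ≤ c) (hF : IsFacet P {x ∈ P | inner ℝ g x = c}) :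
    ∃ x ∈ P, inner ℝ g x < c := by
  by_contra! hcon
  refine hP.not_isFacet_self ?_
  have : {x ∈ P | inner ℝ g x = c} = P :=
    Set.sep_eq_self_iff_mem_true.2 fun x hx => (hle x hx).antisymm (hcon x hx)
  rwa [this] at hF

theorem IsDPolytope.interior_nonempty (hP : IsDPolytope P) : (interior P).Nonempty :=
  hP.convex.interior_nonempty_iff_affineSpan_eq_top.2 hP.2

theorem inner_lt_of_mem_interior {g z : EuclideanSpace ℝ (Fin d)} {c : ℝ}
    (hle : ∀ x ∈ P, inner ℝ g x ≤ c) (hlt : ∃ x, inner ℝ g x < c) (hz : z ∈ interior P) :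
    inner ℝ g z < c := by
  refine lt_of_le_of_ne (hle z (interior_subset hz)) fun heq => ?_
  have hmax : IsLocalMax (innerSL ℝ g) z := by
    filter_upwards [mem_interior_iff_mem_nhds.1 hz] with y hy
    simpa [heq] using hle y hy
  have h0 := hmax.hasFDerivAt_eq_zero (innerSL ℝ g).hasFDerivAt
  have h1 : ∀ x, inner ℝ g x = (0 : ℝ) := fun x => by
    simpa using congrArg (fun l => l x) h0
  obtain ⟨x, hx⟩ := hlt
  rw [h1] at heq hx
  exact hx.ne heq

/-- A point outside a polytope violates an inequality `⟪y, p - z⟫ ≤ 1` that is tight at vertices `p`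
for which the vectors `p - z` span the space. Here `y` is found as an extreme point of the polar of
the polytope with respect to its interior point `z`. -/
theorem exists_extreme_polar {n : ℕ} {v : Fin n → EuclideanSpace ℝ (Fin d)}
    (hv : P = convexHull ℝ (Set.range v)) {z x : EuclideanSpace ℝ (Fin d)} (hz : z ∈ interior P)
    (hx : x ∉ P) : ∃ y : EuclideanSpace ℝ (Fin d), (∀ i, inner ℝ y (v i - z) ≤ 1) ∧
      1 < inner ℝ y (x - z) ∧
      Submodule.span ℝ ((fun i => v i - z) '' {i | inner ℝ y (v i - z) = 1}) = ⊤ := by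
  set D : Set (EuclideanSpace ℝ (Fin d)) := {y | ∀ i, inner ℝ y (v i - z) ≤ 1} with hD
  have hconv : Convex ℝ P := hv ▸ convex_convexHull ℝ _
  have hDP : ∀ y ∈ D, ∀ p ∈ P, inner ℝ y (p - z) ≤ 1 := by
    intro y hy p hp
    have hsub : Set.range v ⊆ {p | inner ℝ y p ≤ 1 + inner ℝ y z} := by
      rintro _ ⟨i, rfl⟩
      have := hy i
      rw [inner_sub_right] at this
      exact show inner ℝ y (v i) ≤ 1 + inner ℝ y z by linarith
    have : inner ℝ y p ≤ 1 + inner ℝ y z :=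
      convexHull_min hsub (convex_halfSpace_le (innerₗ _ y).isLinear _) (hv ▸ hp)
    rw [inner_sub_right]
    linarith
  have hDclosed : IsClosed D := by
    simp only [hD, Set.ofPred_forall]
    exact isClosed_iInter fun i =>
      isClosed_le (continuous_id.inner continuous_const) continuous_const
  have hDcompact : IsCompact D := by
    obtain ⟨ε, hε, hball⟩ := Metric.nhds_basis_closedBall.mem_iff.1
      (mem_interior_iff_mem_nhds.1 hz)
    refine Metric.isCompact_of_isClosed_isBounded hDclosed
      (isBounded_iff_forall_norm_le.2 ⟨ε⁻¹, fun y hy => ?_⟩)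
    rcases eq_or_ne y 0 with rfl | h0
    · simpa using hε.le
    have hpos := norm_pos_iff.2 h0
    have hmem : z + (ε / ‖y‖) • y ∈ P := hball (by
      rw [Metric.mem_closedBall, dist_self_add_left, norm_smul, norm_div, norm_norm,
        Real.norm_of_nonneg hε.le, div_mul_cancel₀ _ hpos.ne'])
    have h1 := hDP y hy _ hmem
    rw [add_sub_cancel_left, inner_smul_right, real_inner_self_eq_norm_sq, sq, ← mul_assoc,
      div_mul_cancel₀ _ hpos.ne'] at h1
    rwa [← one_div, le_div_iff₀' hε]
  obtain ⟨y₀, hy₀, hy₀x⟩ : ∃ y ∈ D, 1 < inner ℝ y (x - z) := by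
    have hclosed : IsClosed P := hv ▸ (Set.finite_range v).isClosed_convexHull ℝ
    obtain ⟨l, b, hl, hb⟩ := geometric_hahn_banach_closed_point hconv hclosed hx
    have hlz := hl z (interior_subset hz)
    have hdual : ∀ p, inner ℝ ((b - l z)⁻¹ • (InnerProductSpace.toDual ℝ _).symm l) p =
        (b - l z)⁻¹ * l p := fun p => by
      rw [inner_smul_left, InnerProductSpace.toDual_symm_apply]
      simp
    refine ⟨(b - l z)⁻¹ • (InnerProductSpace.toDual ℝ _).symm l, fun i => ?_, ?_⟩
    · rw [hdual, map_sub, inv_mul_le_iff₀ (sub_pos.2 hlz)]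
      linarith [hl (v i) (hv ▸ subset_convexHull ℝ _ (Set.mem_range_self i))]
    · rw [hdual, map_sub, lt_inv_mul_iff₀ (sub_pos.2 hlz)]
      linarith
  -- an extreme point of the polar that maximizes the violation at `x`
  have hK : IsExposed ℝ D ((innerSL ℝ (x - z)).toExposed D) :=
    ContinuousLinearMap.toExposed.isExposed
  have hKne : ((innerSL ℝ (x - z)).toExposed D).Nonempty := by
    obtain ⟨y, hy, hmax⟩ := hDcompact.exists_isMaxOn ⟨y₀, hy₀⟩
      (innerSL ℝ (x - z)).continuous.continuousOn
    exact ⟨y, hy, fun y' hy' => hmax hy'⟩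
  obtain ⟨y, hy⟩ := (hK.isCompact hDcompact).extremePoints_nonempty hKne
  have hyD := hK.isExtreme.extremePoints_subset_extremePoints hy
  refine ⟨y, hyD.1, ?_, ?_⟩
  · have := (extremePoints_subset hy).2 y₀ hy₀
    simp only [innerSL_apply_apply] at this
    rw [← real_inner_comm y₀] at hy₀x
    rw [← real_inner_comm y]
    exact hy₀x.trans_le this
  · -- otherwise `y` could be moved in both directions orthogonal to the tight vectors
    rw [← Submodule.orthogonal_eq_bot_iff, Submodule.eq_bot_iff]
    intro w hw
    have hw0 : ∀ i, inner ℝ y (v i - z) = 1 → inner ℝ w (v i - z) = 0 := fun i hi =>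
      Submodule.inner_left_of_mem_orthogonal
        (Submodule.subset_span (Set.mem_image_of_mem (fun i => v i - z) hi)) hw
    obtain ⟨ε, hε, hεK⟩ := exists_pos_forall_add_mul_nonneg
      (fun i => 1 - inner ℝ y (v i - z)) (fun i => -|inner ℝ w (v i - z)|) Set.univ
      (fun i _ => sub_nonneg.2 (hyD.1 i)) fun i _ h0 => by
        rw [hw0 i (sub_eq_zero.1 h0).symm]; simp
    have hmem : ∀ t : ℝ, |t| = ε → y + t • w ∈ D := by
      intro t ht i
      rw [inner_add_left, inner_smul_left, conj_trivial]
      have h1 := hεK i trivial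
      have h2 := le_abs_self (t * inner ℝ w (v i - z))
      rw [abs_mul, ht] at h2
      linarith
    have h1 := hmem ε (abs_of_pos hε)
    have h2 := hmem (-ε) (by rw [abs_neg, abs_of_pos hε])
    have h3 : y ∈ openSegment ℝ (y + ε • w) (y + (-ε) • w) :=
      ⟨1 / 2, 1 / 2, by norm_num, by norm_num, by norm_num, by module⟩
    have h4 := hyD.2 h1 h2 h3
    rw [add_eq_left] at h4
    exact (smul_eq_zero.1 h4).resolve_left hε.ne'

/-- A point satisfying one inequality for each facet of a polytope belongs to the polytope. -/
theorem IsDPolytope.mem_of_forall_facet (hd : 1 ≤ d) (hP : IsDPolytope P) {n : ℕ}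
    {v : Fin n → EuclideanSpace ℝ (Fin d)} (hv : P = convexHull ℝ (Set.range v))
    {x : EuclideanSpace ℝ (Fin d)}
    (hx : ∀ F, IsFacet P F → ∃ (g : EuclideanSpace ℝ (Fin d)) (c : ℝ),
      (∀ p ∈ P, inner ℝ g p ≤ c) ∧ F = {p ∈ P | inner ℝ g p = c} ∧ inner ℝ g x ≤ c) :
    x ∈ P := by
  by_contra hxP
  obtain ⟨z, hz⟩ := hP.interior_nonempty
  obtain ⟨y, hy, hyx, hspan⟩ := exists_extreme_polar hv hz hxP
  have hvP : ∀ i, v i ∈ P := fun i => hv ▸ subset_convexHull ℝ _ (Set.mem_range_self i)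
  have hyP : ∀ p ∈ P, inner ℝ y p ≤ 1 + inner ℝ y z := by
    intro p hp
    rw [hv] at hp
    refine convexHull_min ?_ (convex_halfSpace_le (innerₗ _ y).isLinear (1 + inner ℝ y z)) hp
    rintro _ ⟨i, rfl⟩
    have := hy i
    rw [inner_sub_right] at this
    exact show inner ℝ y (v i) ≤ 1 + inner ℝ y z by linarith
  set F : Set (EuclideanSpace ℝ (Fin d)) := {p ∈ P | inner ℝ y p = 1 + inner ℝ y z} with hF
  have hmemF : ∀ i, inner ℝ y (v i - z) = 1 → v i ∈ F := fun i hi =>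
    ⟨hvP i, by rw [inner_sub_right] at hi; linarith⟩
  have hNZ : NeZero d := ⟨by omega⟩
  obtain ⟨i₀, hi₀⟩ : ∃ i, inner ℝ y (v i - z) = 1 := by
    by_contra! hcon
    have : {i | inner ℝ y (v i - z) = 1} = ∅ :=
      Set.eq_empty_of_forall_notMem fun i hi => hcon i hi
    rw [this, Set.image_empty, Submodule.span_empty] at hspan
    exact bot_ne_top hspan
  have hexp : IsExposed ℝ P F := by
    intro _
    refine ⟨innerSL ℝ y, ?_⟩
    ext p
    simp only [hF, Set.mem_ofPred_eq, innerSL_apply_apply]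
    refine and_congr_right fun hp => ⟨fun h q hq => h ▸ hyP q hq, fun h => ?_⟩
    exact (hyP p hp).antisymm ((hmemF i₀ hi₀).2 ▸ h _ (hvP i₀))
  have hfacet : IsFacet P F := by
    refine ⟨hexp, ⟨_, hmemF i₀ hi₀⟩, le_antisymm ?_ ?_⟩
    · have hle : vectorSpan ℝ F ≤ LinearMap.ker (innerₗ _ y) := by
        rw [vectorSpan_def, Submodule.span_le]
        rintro _ ⟨p, hp, q, hq, rfl⟩
        simp [inner_sub_right, hp.2, hq.2]
      have hlt : vectorSpan ℝ F < ⊤ := by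
        refine lt_top_iff_ne_top.2 fun htop => ?_
        have h1 : x - z ∈ LinearMap.ker (innerₗ _ y) := hle (htop ▸ trivial)
        rw [LinearMap.mem_ker, innerₗ_apply_apply] at h1
        linarith
      have := Submodule.finrank_lt hlt.ne
      rwa [finrank_euclideanSpace_fin] at this
    · have hle : (⊤ : Submodule ℝ (EuclideanSpace ℝ (Fin d))) ≤
          vectorSpan ℝ F ⊔ Submodule.span ℝ {v i₀ - z} := by
        rw [← hspan, Submodule.span_le]
        rintro _ ⟨i, hi, rfl⟩
        have h1 := Submodule.add_mem_sup (vsub_mem_vectorSpan ℝ (hmemF i hi) (hmemF i₀ hi₀))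
          (Submodule.mem_span_singleton_self (R := ℝ) (v i₀ - z))
        simpa using h1
      have h1 := Submodule.finrank_mono hle
      rw [finrank_top, finrank_euclideanSpace_fin] at h1
      have hne : v i₀ - z ≠ 0 := fun h0 => by simp [h0] at hi₀
      rw [← finrank_span_singleton (K := ℝ) hne]
      exact h1.trans (Submodule.finrank_add_le_finrank_add_finrank _ _)
  obtain ⟨g, c, hgP, hgF, hgx⟩ := hx F hfacet
  have hgz : inner ℝ g z < c := by
    obtain ⟨p, -, hp⟩ := hP.exists_inner_lt hgP (hgF ▸ hfacet)
    exact inner_lt_of_mem_interior hgP ⟨p, hp⟩ hz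
  -- the two inequalities for the facet `F` are proportional
  have hprop : ∀ w : EuclideanSpace ℝ (Fin d),
      inner ℝ g w - (c - inner ℝ g z) * inner ℝ y w = 0 := by
    intro w
    have hle : Submodule.span ℝ ((fun i => v i - z) '' {i | inner ℝ y (v i - z) = 1}) ≤
        LinearMap.ker (innerₗ _ g - (c - inner ℝ g z) • innerₗ _ y) := by
      rw [Submodule.span_le]
      rintro _ ⟨i, hi, rfl⟩
      have h1 := hmemF i hi
      rw [hgF] at h1
      have h2 : inner ℝ y (v i - z) = 1 := hi
      simp [h2, inner_sub_right g, h1.2]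
    rw [hspan] at hle
    exact hle (x := w) trivial
  have h1 := hprop (x - z)
  rw [inner_sub_right g] at h1
  nlinarith

/-- Every polytope has a slack matrix. -/
theorem IsDPolytope.exists_isSlackMatrix (hd : 1 ≤ d) (hP : IsDPolytope P) :
    ∃ (n m : ℕ) (S : Matrix (Fin n) (Fin m) ℝ), IsSlackMatrix P S := by
  obtain ⟨n, v, hvinj, hvr⟩ := hP.finite_extremePoints.fin_param
  have hv : P = convexHull ℝ (Set.range v) := by rw [hvr, hP.convexHull_extremePoints]
  have hfin : {F | IsFacet P F}.Finite := by
    refine Set.Finite.of_injOn (f := fun F => {i | v i ∈ F}) (t := Set.univ)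
      (fun _ _ => trivial) (fun F hF G hG hFG => ?_) Set.finite_univ
    have hiff : ∀ i, v i ∈ F ↔ v i ∈ G := fun i => Set.ext_iff.1 hFG i
    exact (exposed_subset_of_eq_convexHull hv hF.1 hG.1 fun i => (hiff i).1).antisymm
      (exposed_subset_of_eq_convexHull hv hG.1 hF.1 fun i => (hiff i).2)
  obtain ⟨m, Φ, hΦinj, hΦr⟩ := hfin.fin_param
  have hΦ : ∀ j, IsFacet P (Φ j) := fun j => hΦr.subset (Set.mem_range_self j)
  choose g c hle hgF using fun j => exists_inner_of_isExposed (hΦ j).1 (hΦ j).2.1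
  refine ⟨n, m, Matrix.of fun i j => c j - inner ℝ (g j) (v i), v, g, c, hvinj, hvr, ?_,
    fun j => hgF j ▸ hΦ j, ?_, fun i j => rfl⟩
  · refine Set.Subset.antisymm (fun x hx j => hle j x hx) fun x hx => ?_
    refine hP.mem_of_forall_facet hd hv fun F hF => ?_
    obtain ⟨j, rfl⟩ := hΦr.superset hF
    exact ⟨g j, c j, hle j, hgF j, hx j⟩
  · simpa only [← hgF] using hΦinj

end Facets

/-! ### Inscribability and certificates -/

section Certificates

variable {d n m : ℕ} {P : Set (EuclideanSpace ℝ (Fin d))} {S₀ : Matrix (Fin n) (Fin m) ℝ}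

/-- Any bordered matrix whose block `S` has the support of a slack matrix has rank at
least `d + 1`. -/
theorem IsDoubleDescription.le_rank_bordered (hd : 1 ≤ d) (hPd : IsDPolytope P)
    {v : Fin n → EuclideanSpace ℝ (Fin d)} {g : Fin m → EuclideanSpace ℝ (Fin d)} {c : Fin m → ℝ}
    (hP : IsDoubleDescription P v g c) (A : Matrix (Fin n) (Fin n) ℝ)
    {S : Matrix (Fin n) (Fin m) ℝ} (B : Matrix (Fin m) (Fin m) ℝ)
    (hS : ∀ i j, S i j = 0 ↔ inner ℝ (g j) (v i) = c j) :
    d + 1 ≤ (bordered A S B).rank := by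
  have hnt := hPd.nontrivial hd
  have hspan := hP.span_homPoint_eq_top hnt.nonempty hPd.2
  -- the rows of the matrix indexed by the points realize the incidence relation
  have h1 := hP.realizes.finrank_le_finrank (hP.mem_coneOn hnt) (hP.isExtent_empty hnt)
    (u := fun i => (bordered A S B).row (Sum.inr (Sum.inl i)))
    (f := fun j => LinearMap.proj (Sum.inr (Sum.inr j)))
    (fun i j => by simpa [bordered, incidence] using hS i j)
  rw [hspan, finrank_top, Module.finrank_prod, Module.finrank_self,
    finrank_euclideanSpace_fin, add_comm] at h1
  rw [Matrix.rank_eq_finrank_span_row]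
  refine h1.trans (Submodule.finrank_mono (Submodule.span_mono ?_))
  rintro _ ⟨i, rfl⟩
  exact Set.mem_range_self _

/-- An inscribed polytope combinatorially equivalent to `P`, recentred at an interior point, gives
point configurations `p`, `q` on the unit sphere and in space whose matrix `1 + ⟪p i, q j⟫` has the
support of the slack matrix of `P`. -/
theorem IsInscribable.exists_points (hPd : IsDPolytope P)
    {v : Fin n → EuclideanSpace ℝ (Fin d)} {g : Fin m → EuclideanSpace ℝ (Fin d)} {c : Fin m → ℝ}
    (hP : IsDoubleDescription P v g c) (hv : ∀ i, v i ∈ P.extremePoints ℝ)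
    (hfacet : ∀ j, IsFacet P {x ∈ P | inner ℝ (g j) x = c j}) (hins : IsInscribable P) :
    ∃ (p : Fin n → EuclideanSpace ℝ (Fin d)) (q : Fin m → EuclideanSpace ℝ (Fin d)),
      (∀ i, ‖p i‖ = 1) ∧ (∀ i j, 0 ≤ 1 + inner ℝ (p i) (q j)) ∧
        ∀ i j, 1 + inner ℝ (p i) (q j) = 0 ↔ inner ℝ (g j) (v i) = c j := by
  obtain ⟨Q, hQ, ⟨φ⟩, o, r, hr, hsphere⟩ := hins
  choose w hw hwφ using fun i => hPd.exists_vertex_of_orderIso hQ φ (hv i)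
  have hwQ : ∀ i, w i ∈ Q := fun i => extremePoints_subset (hw i)
  let F : Fin m → FaceLattice P := fun j => ⟨_, (hfacet j).1⟩
  have hGne : ∀ j, (φ (F j)).1.Nonempty := fun j => nonempty_of_orderIso φ (hfacet j).2.1
  choose γ β hle hG using fun j => exists_inner_of_isExposed (φ (F j)).2 (hGne j)
  have htight : ∀ i j, inner ℝ (γ j) (w i) = β j ↔ inner ℝ (g j) (v i) = c j := by
    intro i j
    have h1 := hwφ i (F j)
    rw [hG j] at h1
    exact ⟨fun h => (h1.2 ⟨hwQ i, h⟩).2, fun h => (h1.1 ⟨(hv i).1, h⟩).2⟩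
  have hlt : ∀ j, ∃ x, inner ℝ (γ j) x < β j := by
    intro j
    by_contra! hcon
    refine hPd.not_isFacet_self ?_
    have hPF : P ⊆ {x ∈ P | inner ℝ (g j) x = c j} :=
      exposed_subset_of_eq_convexHull hP.eq_convexHull (IsExposed.refl P) (hfacet j).1
        fun i _ => ⟨(hv i).1, (htight i j).1 ((hle j _ (hwQ i)).antisymm (hcon _))⟩
    have hj := hfacet j
    rwa [(Set.sep_subset _ _).antisymm hPF] at hj
  obtain ⟨z, hz⟩ := hQ.interior_nonempty
  -- normalize the sphere to the unit sphere
  let ν : EuclideanSpace ℝ (Fin d) → EuclideanSpace ℝ (Fin d) := fun x => r⁻¹ • (x - o)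
  have hν : ∀ j x, (β j - inner ℝ (γ j) o) - inner ℝ (r • γ j) (ν x) =
      β j - inner ℝ (γ j) x := by
    intro j x
    simp only [ν]
    rw [inner_smul_left, inner_smul_right, conj_trivial, mul_inv_cancel_left₀ hr.ne',
      inner_sub_right]
    ring
  have hνw : ∀ i, ‖ν (w i)‖ = 1 := by
    intro i
    have := hsphere (hw i)
    rw [mem_sphere_iff_norm] at this
    rw [norm_smul, this, norm_inv, Real.norm_of_nonneg hr.le, inv_mul_cancel₀ hr.ne']
  have hνz : ‖ν z‖ < 1 := by
    have hsub : Q ⊆ Metric.closedBall o r := by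
      rw [← hQ.convexHull_extremePoints]
      exact convexHull_min (hsphere.trans Metric.sphere_subset_closedBall)
        (convex_closedBall o r)
    have := interior_mono hsub hz
    rw [interior_closedBall o hr.ne', mem_ball_iff_norm] at this
    rwa [norm_smul, norm_inv, Real.norm_of_nonneg hr.le, inv_mul_lt_iff₀ hr, mul_one]
  obtain ⟨T, D, hT, hD⟩ := exists_recentering hνz
  have hpos : ∀ i j, ∃ t > 0, 1 + inner ℝ (T (ν (w i))) (-D (r • γ j) (β j - inner ℝ (γ j) o)) =
      t * (β j - inner ℝ (γ j) (w i)) := by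
    intro i j
    obtain ⟨t, ht, heq⟩ := hD (ν (w i)) (r • γ j) (β j - inner ℝ (γ j) o) (hνw i) (by
      rw [← sub_pos, hν, sub_pos]
      exact inner_lt_of_mem_interior (hle j) (hlt j) hz)
    refine ⟨t, ht, ?_⟩
    rw [inner_neg_right, real_inner_comm, ← sub_eq_add_neg, heq, hν]
  refine ⟨fun i => T (ν (w i)), fun j => -D (r • γ j) (β j - inner ℝ (γ j) o),
    fun i => hT _ (hνw i), fun i j => ?_, fun i j => ?_⟩
  · obtain ⟨t, ht, heq⟩ := hpos i j
    rw [heq]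
    exact mul_nonneg ht.le (sub_nonneg.2 (hle j _ (hwQ i)))
  · obtain ⟨t, ht, heq⟩ := hpos i j
    rw [heq, ← htight, mul_eq_zero, or_iff_right ht.ne', sub_eq_zero, eq_comm]

theorem IsSlackMatrix.exists_isDoubleDescription (hPd : IsDPolytope P) (hS₀ : IsSlackMatrix P S₀) :
    ∃ (v : Fin n → EuclideanSpace ℝ (Fin d)) (g : Fin m → EuclideanSpace ℝ (Fin d))
      (c : Fin m → ℝ), IsDoubleDescription P v g c ∧ (∀ i, v i ∈ P.extremePoints ℝ) ∧
        (∀ j, IsFacet P {x ∈ P | inner ℝ (g j) x = c j}) ∧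
        ∀ i j, S₀ i j = 0 ↔ inner ℝ (g j) (v i) = c j := by
  obtain ⟨v, g, c, -, hv, hP, hfacet, -, hS⟩ := hS₀
  refine ⟨v, g, c, ⟨?_, hP⟩, fun i => hv ▸ Set.mem_range_self i, hfacet, fun i j => ?_⟩
  · rw [hv, hPd.convexHull_extremePoints]
  · rw [hS, sub_eq_zero, eq_comm]

theorem IsInscribable.exists_isFeasible (hd : 1 ≤ d) (hPd : IsDPolytope P)
    (hS₀ : IsSlackMatrix P S₀) (hins : IsInscribable P) :
    ∃ A S B, IsFeasible S₀ A S B ∧ (bordered A S B).rank = d + 1 := by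
  obtain ⟨v, g, c, hP, hv, hfacet, hzero⟩ := hS₀.exists_isDoubleDescription hPd
  obtain ⟨p, q, hp, hnn, hpq⟩ := hins.exists_points hPd hP hv hfacet
  refine ⟨onePlusInner p p, onePlusInner p q, onePlusInner q q,
    ⟨posSemidef_bordered_onePlusInner p q, fun i j h0 => ?_, fun i j h0 => ?_, fun i => ?_⟩,
    (rank_bordered_onePlusInner_le p q).antisymm (hP.le_rank_bordered hd hPd _ _ hpq)⟩
  · exact (hpq i j).2 ((hzero i j).1 h0)
  · exact lt_of_le_of_ne (hnn i j) fun h => h0 ((hzero i j).2 ((hpq i j).1 h.symm))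
  · simp only [onePlusInner, Matrix.of_apply, real_inner_self_eq_norm_sq, hp]
    norm_num

theorem IsFeasible.sameSupport {A : Matrix (Fin n) (Fin n) ℝ} {S : Matrix (Fin n) (Fin m) ℝ}
    {B : Matrix (Fin m) (Fin m) ℝ} (h : IsFeasible S₀ A S B) : SameSupport S S₀ :=
  fun i j => ⟨fun h1 h2 => h1 (h.2.1 i j h2), fun h1 => (h.2.2.1 i j h1).ne'⟩

theorem IsFeasible.isCertificate {A : Matrix (Fin n) (Fin n) ℝ} {S : Matrix (Fin n) (Fin m) ℝ}
    {B : Matrix (Fin m) (Fin m) ℝ} (h : IsFeasible S₀ A S B)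
    (hrank : (bordered A S B).rank = d + 1) : IsCertificate d S₀ A S B := by
  refine ⟨h.1, hrank, ⟨2, h.2.2.2⟩, fun i j => ?_, h.sameSupport⟩
  by_cases h0 : S₀ i j = 0
  · exact (h.2.1 i j h0).ge
  · exact (h.2.2.1 i j h0).le

theorem IsFeasible.le_rank (hd : 1 ≤ d) (hPd : IsDPolytope P) (hS₀ : IsSlackMatrix P S₀)
    {A : Matrix (Fin n) (Fin n) ℝ} {S : Matrix (Fin n) (Fin m) ℝ}
    {B : Matrix (Fin m) (Fin m) ℝ} (h : IsFeasible S₀ A S B) :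
    d + 1 ≤ (bordered A S B).rank := by
  obtain ⟨v, g, c, hP, -, -, hzero⟩ := hS₀.exists_isDoubleDescription hPd
  exact hP.le_rank_bordered hd hPd A B fun i j => (not_iff_not.1 (h.sameSupport i j)).trans
    (hzero i j)

theorem IsCertificate.isInscribable (hd : 1 ≤ d) (hPd : IsDPolytope P)
    (hS₀ : IsSlackMatrix P S₀) {A : Matrix (Fin n) (Fin n) ℝ} {S : Matrix (Fin n) (Fin m) ℝ}
    {B : Matrix (Fin m) (Fin m) ℝ} (h : IsCertificate d S₀ A S B) : IsInscribable P := by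
  obtain ⟨hpsd, hrank, ⟨a, ha⟩, hnn, hsupp⟩ := h
  obtain ⟨v, g, c, hP, -, -, hzero⟩ := hS₀.exists_isDoubleDescription hPd
  obtain ⟨p, q, hS, hA⟩ := exists_eq_one_add_inner hpsd hrank
  have hin : ∀ i j, inner ℝ (-q j) (p i) = 1 - S i j := fun i j => by
    rw [inner_neg_left, real_inner_comm, hS]; ring
  obtain ⟨hQ, hPQ⟩ := hP.exists_combEquiv hd hPd (p := p) (q := fun j => -q j) (b := fun _ => 1)
    (fun i j => by rw [hin]; linarith [hnn i j])
    (fun i j => by rw [hin, sub_eq_self, not_iff_not.1 (hsupp i j), hzero])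
  have hnorm : ∀ i k, ‖p i‖ = ‖p k‖ := fun i k => by
    have h1 := (hA i).symm.trans ((ha i).trans ((ha k).symm.trans (hA k)))
    exact (sq_eq_sq₀ (norm_nonneg _) (norm_nonneg _)).1 (by linarith)
  obtain ⟨i₀, hi₀⟩ : ∃ i, p i ≠ 0 := by
    by_contra! hcon
    have hsub : convexHull ℝ (Set.range p) ⊆ {0} := by
      refine convexHull_min ?_ (convex_singleton 0)
      rintro _ ⟨i, rfl⟩
      exact hcon i
    exact Set.not_nontrivial_iff.2 (Set.subsingleton_singleton.anti hsub) (hQ.nontrivial hd)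
  refine ⟨_, hQ, hPQ, 0, ‖p i₀‖, norm_pos_iff.2 hi₀, extremePoints_convexHull_subset.trans ?_⟩
  rintro _ ⟨i, rfl⟩
  rw [mem_sphere_zero_iff_norm]
  exact hnorm i i₀

end Certificates

end Inscribability

theorem mainTheorem1 (d : ℕ) (hd : 1 ≤ d) (P : Set (EuclideanSpace ℝ (Fin d)))
    (hP : Inscribability.IsDPolytope P) :
    (Inscribability.IsInscribable P ↔
      ∃ (n m : ℕ) (S₀ : Matrix (Fin n) (Fin m) ℝ), Inscribability.IsSlackMatrix P S₀ ∧
        ∃ A S B, Inscribability.IsCertificate d S₀ A S B) ∧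
    (∀ (n m : ℕ) (S₀ : Matrix (Fin n) (Fin m) ℝ), Inscribability.IsSlackMatrix P S₀ →
      (Inscribability.IsInscribable P ↔ ∃ A S B, Inscribability.IsCertificate d S₀ A S B) ∧
      (Inscribability.IsInscribable P ↔ IsLeast (Inscribability.feasibleRanks S₀) (d + 1))) := by
  have hcert : ∀ (n m : ℕ) (S₀ : Matrix (Fin n) (Fin m) ℝ), Inscribability.IsSlackMatrix P S₀ →
      (Inscribability.IsInscribable P ↔ ∃ A S B, Inscribability.IsCertificate d S₀ A S B) := by
    refine fun n m S₀ hS₀ => ⟨fun h => ?_, fun ⟨A, S, B, h⟩ => h.isInscribable hd hP hS₀⟩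
    obtain ⟨A, S, B, hf, hrank⟩ := h.exists_isFeasible hd hP hS₀
    exact ⟨A, S, B, hf.isCertificate hrank⟩
  refine ⟨⟨fun h => ?_, fun ⟨n, m, S₀, hS₀, h⟩ => (hcert n m S₀ hS₀).2 h⟩,
    fun n m S₀ hS₀ => ⟨hcert n m S₀ hS₀, fun h => ⟨?_, ?_⟩, fun h => ?_⟩⟩
  · obtain ⟨n, m, S₀, hS₀⟩ := hP.exists_isSlackMatrix hd
    exact ⟨n, m, S₀, hS₀, (hcert n m S₀ hS₀).1 h⟩
  · exact h.exists_isFeasible hd hP hS₀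
  · rintro _ ⟨A, S, B, hf, rfl⟩
    exact hf.le_rank hd hP hS₀
  · obtain ⟨A, S, B, hf, hrank⟩ := h.1
    exact (hcert n m S₀ hS₀).2 ⟨A, S, B, hf.isCertificate hrank⟩
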